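/- Let $K$ be an algebraically closed field which is complete with respect to a non-trivial non-archimedean absolute value $|\cdot|$, and let $p\ge 0$ be the characteristic of its residue field. Let $\varphi(z)\in K(z)$ be a rational function of degree $d\ge 2$, acting on $\mathbb{P}^1(K)$, and suppose that either $p=0$ or $d<p$. Let $n\ge 1$ and let $\gamma\in\mathbb{P}^1(K)$ be a point with $\varphi^n(\gamma)=\gamma$ whose multiplier $(\varphi^n)'(\gamma)$ (computed in a coordinate in which $\gamma\ne\infty$) satisfies $$0<|(\varphi^n)'(\gamma)|<1 .$$ Then there is a critical point $c\in\mathbb{P}^1(K)$ of $\varphi$ that is strictly attracted to the cycle containing $\gamma$; that is, for some $0\le k\le n-1$ we have $\lim_{m\to\infty}\varphi^{nm}(c)=\varphi^k(\gamma)$ in $\mathbb{P}^1(K)$, and $\varphi^l(c)\ne\gamma$ for all $l\ge 1$. -/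

import Mathlib

/-!
Rational functions over a field `K`, acting on the projective line `P¹(K) = K ∪ {∞}`, which is
modelled by `OnePoint K`. The topology that Mathlib puts on `OnePoint K` (one-point
compactification) is not the one of `P¹(K)` when `K` is not locally compact, and is not used here:
convergence in `P¹(K)` is convergence for the chordal metric `RationalDynamics.chordalDist`.
-/

namespace RationalDynamics

noncomputable section

section Algebra

variable {K : Type*} [Field K]

/-- The degree of a rational function written in lowest terms. -/
def degree (φ : RatFunc K) : ℕ :=
  max φ.num.natDegree φ.denom.natDegree

open Classical in
/-- The self-map of `P¹(K)` induced by a rational function. With `d = degree φ`, the value at `∞` is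
the quotient of the coefficients of `z ^ d` in the numerator and in the denominator. -/
def toMap (φ : RatFunc K) : OnePoint K → OnePoint K
  | none =>
    if φ.denom.coeff (degree φ) = 0 then OnePoint.infty
    else ((φ.num.coeff (degree φ) / φ.denom.coeff (degree φ) : K) : OnePoint K)
  | some a =>
    if φ.denom.eval a = 0 then OnePoint.infty
    else ((φ.num.eval a / φ.denom.eval a : K) : OnePoint K)

/-- The composition `φ ∘ ψ` of rational functions (meaningful for nonconstant `ψ`),
obtained by substituting `ψ` for the variable of `φ`. -/
def comp (φ ψ : RatFunc K) : RatFunc K :=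
  φ.eval RatFunc.C ψ

/-- The `n`-fold composition `φⁿ = φ ∘ ⋯ ∘ φ`. -/
def iter (φ : RatFunc K) : ℕ → RatFunc K
  | 0 => RatFunc.X
  | n + 1 => comp φ (iter φ n)

/-- The formal derivative of a rational function, evaluated at a point that is not a pole. -/
def derivAt (φ : RatFunc K) (a : K) : K :=
  (φ.num.derivative.eval a * φ.denom.eval a - φ.num.eval a * φ.denom.derivative.eval a) /
    φ.denom.eval a ^ 2

/-- The standard local coordinate of a point `x` of `P¹(K)`: the coordinate `z` if `x ≠ ∞`,
and the coordinate `1 / z` if `x = ∞`. -/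
def localCoord : OnePoint K → K
  | none => 0
  | some a => a

open Classical in
/-- The map `φ` expressed in the standard local coordinate at `x` on the source
and in the standard local coordinate at `y` on the target. -/
def inCharts (φ : RatFunc K) (x y : OnePoint K) : RatFunc K :=
  let ψ := if x = OnePoint.infty then comp φ (RatFunc.X)⁻¹ else φ
  if y = OnePoint.infty then ψ⁻¹ else ψ

/-- The derivative of `φ` at `x`, in the standard local coordinates at `x` and at `y = φ(x)`. -/
def localDeriv (φ : RatFunc K) (x y : OnePoint K) : K :=
  derivAt (inCharts φ x y) (localCoord x)

/-- `x ∈ P¹(K)` is a critical point of `φ`: the derivative of `φ` vanishes at `x`, in local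
coordinates at `x` and `φ(x)`. -/
def IsCriticalPoint (φ : RatFunc K) (x : OnePoint K) : Prop :=
  localDeriv φ x (toMap φ x) = 0

/-- `(φⁿ)'(γ)` for a point with `φⁿ(γ) = γ`. If `γ = ∞`, it is computed after the change of
coordinate `z ↦ 1 / z`. -/
def multiplier (φ : RatFunc K) (n : ℕ) (γ : OnePoint K) : K :=
  localDeriv (iter φ n) γ γ

end Algebra

section Dynamics

variable {K : Type*} [NormedField K]

/-- The chordal metric on `P¹(K)` (in the form used over non-archimedean fields). -/
def chordalDist : OnePoint K → OnePoint K → ℝ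
  | none, none => 0
  | none, some b => 1 / max 1 ‖b‖
  | some a, none => 1 / max 1 ‖a‖
  | some a, some b => ‖a - b‖ / (max 1 ‖a‖ * max 1 ‖b‖)

/-- The cycle of `γ` attracts `x`, where `φⁿ(γ) = γ`:
`φⁿᵐ(x) → φᵏ(γ)` in `P¹(K)` as `m → ∞`, for some `0 ≤ k ≤ n - 1`. -/
def Attracts (φ : RatFunc K) (n : ℕ) (γ x : OnePoint K) : Prop :=
  ∃ k < n, Filter.Tendsto
    (fun m : ℕ => chordalDist ((toMap φ)^[n * m] x) ((toMap φ)^[k] γ)) Filter.atTop (nhds 0)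

/-- The cycle of `γ` strictly attracts `x`: it attracts `x`, and the forward orbit
of `x` does not meet it (equivalently, does not contain `γ`). -/
def StrictlyAttracts (φ : RatFunc K) (n : ℕ) (γ x : OnePoint K) : Prop :=
  Attracts φ n γ x ∧ ∀ l : ℕ, 1 ≤ l → (toMap φ)^[l] x ≠ γ

end Dynamics

/-- The residue field of a non-archimedean normed field: the quotient of the ring
`{x | ‖x‖ ≤ 1}` by its maximal ideal `{x | ‖x‖ < 1}`. -/
abbrev ResidueField (K : Type*) [NormedField K] [IsUltrametricDist K] : Type _ :=
  IsLocalRing.ResidueField (NormedField.valuation (K := K)).valuationSubring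

end

end RationalDynamics

namespace RationalDynamics

open Polynomial

/-! ### Ultrametric estimates for logarithmic derivatives. -/

section Ultrametric

variable {K : Type*} [NormedField K] [IsUltrametricDist K]

/-! If `γ` were the only fixed point of `φ`, it would be a multiple one and its multiplier would be
`1`. So there is a fixed point off the cycle (`exists_fixed_point_ne`). A Möbius change of
coordinate moves it to `∞`: then `φ` becomes `f = P / Q` with `deg Q < deg P`, and the cycle of `g`
(the point `γ`) lies in `K`. Multipliers and critical points survive the change
(`exists_localDeriv_mobius`).

Near `g` the map `f^n` scales distances by exactly `|μ| < 1`, where `μ` is the multiplier, so every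
point entering a small punctured disk `0 < |z - g| < r` is strictly attracted. Suppose no critical
point is. Pull the disk back along the cycle. At each step the new disk is mapped injectively,
because no critical value lies in the punctured disk; so its radius is the old one divided by
`|f'|`. After `nk` steps it is a disk around `g` of radius `r / |μ|^k`, and all its points but `g`
enter the small punctured disk (`entersPuncturedDisk_of_norm_lt`). These radii tend to infinity. But
`f(g)` has a second preimage `x' ≠ g`, because `d ≥ 2` and `g` is not critical. It lies in such a
disk, yet lands on the cycle: a contradiction.

The injectivity step (`no_zeros_poles`) is a Riemann-Hurwitz count. Put `T = P'Q - PQ'`. Then `T /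
(PQ) = P'/P - Q'/Q` is a sum of terms `±1 / (z - a)`. On an annulus free of roots it has absolute
value `1 / |z - c|` as soon as the numbers of zeros and poles inside differ by an integer that is a
unit; this is where `d < p` enters. Hence the orders of `T / (PQ)` add up to `-1` over the disk
(`rootsIn_derivNum`). -/

theorem norm_sub_eq_max_of_ne {a b : K} (h : ‖a‖ ≠ ‖b‖) : ‖a - b‖ = max ‖a‖ ‖b‖ := by
  rw [sub_eq_add_neg, IsUltrametricDist.norm_add_eq_max_of_norm_ne_norm (by simpa using h),
    norm_neg]

theorem norm_sub_le_max' (a b : K) : ‖a - b‖ ≤ max ‖a‖ ‖b‖ := by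
  rw [sub_eq_add_neg, ← norm_neg b]
  exact IsUltrametricDist.norm_add_le_max _ _

theorem norm_eq_of_norm_sub_lt {a b : K} (h : ‖a - b‖ < ‖b‖) : ‖a‖ = ‖b‖ := by
  have := IsUltrametricDist.norm_add_eq_max_of_norm_ne_norm h.ne
  rwa [sub_add_cancel, max_eq_right h.le] at this

/-- An integer combination of the terms `1 / (z - a)` over a multiset of points lying inside and
outside an annulus around `c` is dominated on the annulus by the terms lying inside. -/
theorem norm_sum_one_div_sub_lt {c z : K} {t t' : ℝ} (ht : 0 ≤ t) (hz : t < ‖z - c‖)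
    (hz' : ‖z - c‖ < t') (s : Multiset K) (hs : ∀ a ∈ s, ‖a - c‖ ≤ t ∨ t' ≤ ‖a - c‖) :
    ‖(s.map fun a => 1 / (z - a)).sum -
      ((s.filter fun a => ‖a - c‖ ≤ t).card : K) / (z - c)‖ < 1 / ‖z - c‖ := by
  have hzc : 0 < ‖z - c‖ := ht.trans_lt hz
  have hzc0 : z - c ≠ 0 := norm_pos_iff.1 hzc
  induction s using Multiset.induction_on with
  | empty => simpa using hzc0
  | cons a s ih =>
    have ih' := ih fun b hb => hs b (Multiset.mem_cons_of_mem hb)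
    have hza : z - a = (z - c) - (a - c) := by ring
    -- An inside root contributes `1 / (z - c)` with an error smaller than `1 / ‖z - c‖`, an outside
    -- root contributes less than `1 / ‖z - c‖`, and ultrametric errors do not accumulate.
    rcases hs a (Multiset.mem_cons_self a s) with ha | ha
    · have hlt : ‖a - c‖ < ‖z - c‖ := ha.trans_lt hz
      have hn : ‖z - a‖ = ‖z - c‖ := by
        rw [hza, norm_sub_eq_max_of_ne hlt.ne', max_eq_left hlt.le]
      have hza0 : z - a ≠ 0 := norm_pos_iff.1 (hn ▸ hzc)
      have hterm : ‖1 / (z - a) - 1 / (z - c)‖ < 1 / ‖z - c‖ := by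
        rw [div_sub_div _ _ hza0 hzc0, norm_div, norm_mul, hn]
        have : 1 * (z - c) - (z - a) * 1 = a - c := by ring
        rw [this, div_lt_div_iff₀ (by positivity) hzc, one_mul]
        exact mul_lt_mul_of_pos_right hlt hzc
      rw [Multiset.filter_cons_of_pos (p := fun a => ‖a - c‖ ≤ t) s ha,
        Multiset.map_cons, Multiset.sum_cons, Multiset.card_cons]
      push_cast
      have hsplit : ∀ S m : K, 1 / (z - a) + S - (m + 1) / (z - c)
          = (1 / (z - a) - 1 / (z - c)) + (S - m / (z - c)) := by
        intro S m; ring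
      rw [hsplit]
      exact (IsUltrametricDist.norm_add_le_max _ _).trans_lt (max_lt hterm ih')
    · have hlt : ‖z - c‖ < ‖a - c‖ := hz'.trans_le ha
      have hn : ‖z - a‖ = ‖a - c‖ := by
        rw [hza, norm_sub_eq_max_of_ne hlt.ne, max_eq_right hlt.le]
      have hterm : ‖1 / (z - a)‖ < 1 / ‖z - c‖ := by
        rw [norm_div, hn, norm_one]
        exact one_div_lt_one_div_of_lt hzc hlt
      rw [Multiset.filter_cons_of_neg (p := fun a => ‖a - c‖ ≤ t) s (not_le.2 (hz.trans hlt)),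
        Multiset.map_cons, Multiset.sum_cons, add_sub_assoc]
      exact (IsUltrametricDist.norm_add_le_max _ _).trans_lt (max_lt hterm ih')

end Ultrametric

/-! ### Gauss norms of polynomials on disks. -/

section GaussNorm

variable {K : Type*} [NormedField K]

/-- The maximum of the absolute value of the split polynomial `F` on the closed disk of
centre `c` and radius `t`, in terms of its roots. -/
noncomputable def gaussNorm (F : K[X]) (c : K) (t : ℝ) : ℝ :=
  ‖F.leadingCoeff‖ * (F.roots.map fun a => max ‖a - c‖ t).prod

/-- The number of roots of `F`, with multiplicity, in the closed disk of centre `c` and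
radius `t`. -/
noncomputable def rootsIn (F : K[X]) (c : K) (t : ℝ) : ℕ :=
  (F.roots.filter fun a => ‖a - c‖ ≤ t).card

/-- `F` has no roots in the open annulus `t < |z - c| < t'`. -/
def NoRoots (F : K[X]) (c : K) (t t' : ℝ) : Prop :=
  ∀ a ∈ F.roots, ‖a - c‖ ≤ t ∨ t' ≤ ‖a - c‖

theorem continuous_gaussNorm (F : K[X]) (c : K) : Continuous (gaussNorm F c) := by
  unfold gaussNorm
  exact continuous_const.mul
    (continuous_multiset_prod _ fun a _ => continuous_const.max continuous_id)

theorem gaussNorm_pos {F : K[X]} (hF : F ≠ 0) {c : K} {t : ℝ}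
    (h : 0 < t ∨ (0 ≤ t ∧ F.eval c ≠ 0)) : 0 < gaussNorm F c t := by
  refine mul_pos (norm_pos_iff.2 (leadingCoeff_ne_zero.2 hF)) (Multiset.prod_pos ?_)
  simp only [Multiset.mem_map, forall_exists_index, and_imp, forall_apply_eq_imp_iff₂]
  intro a ha
  rcases h with h | ⟨_, h⟩
  · exact lt_max_of_lt_right h
  · refine lt_max_of_lt_left (norm_pos_iff.2 (sub_ne_zero.2 ?_))
    rintro rfl
    exact h (isRoot_of_mem_roots ha)

theorem gaussNorm_eq_zero {F : K[X]} {c : K} (h : F.IsRoot c) (hF : F ≠ 0) :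
    gaussNorm F c 0 = 0 := by
  refine mul_eq_zero_of_right _ (Multiset.prod_eq_zero ?_)
  exact Multiset.mem_map.2 ⟨c, (mem_roots hF).2 h, by simp⟩

/-- Between the absolute values of the roots, the Gauss norm is a monomial in the radius. -/
theorem exists_gaussNorm_eq {F : K[X]} (hF : F ≠ 0) {c : K} {t t' : ℝ} (ht : 0 ≤ t)
    (hR : NoRoots F c t t') :
    ∃ A > 0, ∀ u, t ≤ u → u ≤ t' → gaussNorm F c u = A * u ^ rootsIn F c t := by
  unfold gaussNorm rootsIn
  have hlc : 0 < ‖F.leadingCoeff‖ := norm_pos_iff.2 (leadingCoeff_ne_zero.2 hF)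
  unfold NoRoots at hR
  suffices H : ∃ A > 0, ∀ u, t ≤ u → u ≤ t' → (F.roots.map fun a => max ‖a - c‖ u).prod
      = A * u ^ (F.roots.filter fun a => ‖a - c‖ ≤ t).card by
    obtain ⟨A, hA, h⟩ := H
    exact ⟨‖F.leadingCoeff‖ * A, mul_pos hlc hA, fun u h1 h2 => by rw [h u h1 h2, mul_assoc]⟩
  generalize F.roots = s at hR
  induction s using Multiset.induction_on with
  | empty => exact ⟨1, one_pos, by simp⟩
  | cons a s ih =>
    obtain ⟨A, hA, h⟩ := ih fun b hb => hR b (Multiset.mem_cons_of_mem hb)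
    by_cases ha : ‖a - c‖ ≤ t
    · refine ⟨A, hA, fun u h1 h2 => ?_⟩
      rw [Multiset.filter_cons_of_pos (p := fun a => ‖a - c‖ ≤ t) s ha,
        Multiset.map_cons, Multiset.prod_cons, Multiset.card_cons, h u h1 h2,
        max_eq_right (ha.trans h1)]
      ring
    · have ha' := (hR a (Multiset.mem_cons_self a s)).resolve_left ha
      refine ⟨‖a - c‖ * A, mul_pos (ht.trans_lt (not_le.1 ha)) hA, fun u h1 h2 => ?_⟩
      rw [Multiset.filter_cons_of_neg (p := fun a => ‖a - c‖ ≤ t) s ha,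
        Multiset.map_cons, Multiset.prod_cons, h u h1 h2, max_eq_left (h2.trans ha')]
      ring

/-- The roots are finite in number. Allowing every smaller outer radius `u` lets several polynomials
share one annulus by taking a minimum. -/
theorem exists_gt_noRoots (F : K[X]) (c : K) (t : ℝ) :
    ∃ t' > t, ∀ u ≤ t', NoRoots F c t u := by
  suffices H : ∀ s : Multiset K, ∃ t' > t, ∀ a ∈ s, ‖a - c‖ ≤ t ∨ t' ≤ ‖a - c‖ by
    obtain ⟨t', h1, h2⟩ := H F.roots
    exact ⟨t', h1, fun u hu a ha => (h2 a ha).imp_right hu.trans⟩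
  intro s
  induction s using Multiset.induction_on with
  | empty => exact ⟨t + 1, by linarith, by simp⟩
  | cons a s ih =>
    obtain ⟨t', h1, h2⟩ := ih
    by_cases ha : ‖a - c‖ ≤ t
    · refine ⟨t', h1, fun b hb => ?_⟩
      rcases Multiset.mem_cons.1 hb with rfl | hb
      exacts [Or.inl ha, h2 b hb]
    · refine ⟨min t' ‖a - c‖, lt_min h1 (not_le.1 ha), fun b hb => ?_⟩
      rcases Multiset.mem_cons.1 hb with rfl | hb
      exacts [Or.inr (min_le_right _ _), (h2 b hb).imp_right (min_le_left _ _).trans]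

theorem exists_lt_noRoots (F : K[X]) (c : K) {t' : ℝ} (ht' : 0 < t') :
    ∃ t, 0 ≤ t ∧ t < t' ∧ ∀ u, t ≤ u → NoRoots F c u t' := by
  suffices H : ∀ s : Multiset K, ∃ t, 0 ≤ t ∧ t < t' ∧ ∀ a ∈ s, ‖a - c‖ ≤ t ∨ t' ≤ ‖a - c‖ by
    obtain ⟨t, h0, h1, h2⟩ := H F.roots
    exact ⟨t, h0, h1, fun u hu a ha => (h2 a ha).imp_left fun h => h.trans hu⟩
  intro s
  induction s using Multiset.induction_on with
  | empty => exact ⟨0, le_rfl, ht', by simp⟩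
  | cons a s ih =>
    obtain ⟨t, h0, h1, h2⟩ := ih
    by_cases ha : t' ≤ ‖a - c‖
    · refine ⟨t, h0, h1, fun b hb => ?_⟩
      rcases Multiset.mem_cons.1 hb with rfl | hb
      exacts [Or.inr ha, h2 b hb]
    · refine ⟨max t ‖a - c‖, le_max_of_le_left h0, max_lt h1 (not_le.1 ha), fun b hb => ?_⟩
      rcases Multiset.mem_cons.1 hb with rfl | hb
      exacts [Or.inl (le_max_right _ _), (h2 b hb).imp_left fun h => h.trans (le_max_left _ _)]

theorem norm_eval_eq [IsAlgClosed K] (F : K[X]) (z : K) :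
    ‖F.eval z‖ = ‖F.leadingCoeff‖ * (F.roots.map fun a => ‖z - a‖).prod := by
  rw [(IsAlgClosed.splits F).eval_eq_prod_roots, norm_mul]
  congr 1
  generalize F.roots = s
  induction s using Multiset.induction_on with
  | empty => simp
  | cons a s ih => simp [ih]

theorem gaussNorm_eq_norm_eval [IsAlgClosed K] (F : K[X]) {c : K} {t : ℝ}
    (h : ∀ a ∈ F.roots, t ≤ ‖a - c‖) :
    gaussNorm F c t = ‖F.eval c‖ := by
  rw [norm_eval_eq, gaussNorm]
  congr 2
  refine Multiset.map_congr rfl fun a ha => ?_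
  rw [max_eq_left (h a ha), norm_sub_rev]

variable [IsUltrametricDist K]

/-- Every point of an ultrametric disk is a centre of it. -/
theorem gaussNorm_congr (F : K[X]) {c c' : K} {t : ℝ} (h : ‖c - c'‖ ≤ t) :
    gaussNorm F c t = gaussNorm F c' t := by
  unfold gaussNorm
  congr 2
  refine Multiset.map_congr rfl fun a _ => ?_
  have h1 : a - c = (a - c') - (c - c') := by ring
  have h2 : a - c' = (a - c) + (c - c') := by ring
  apply le_antisymm
  · refine max_le ?_ (le_max_right _ _)
    rw [h1]
    exact (norm_sub_le_max' _ _).trans (max_le_max_left _ h)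
  · refine max_le ?_ (le_max_right _ _)
    rw [h2]
    exact (IsUltrametricDist.norm_add_le_max _ _).trans (max_le_max_left _ h)

variable [IsAlgClosed K]

/-- Off the circles that carry roots, `‖z - a‖` is the larger of `‖z - c‖` and `‖a - c‖`, so a point
behaves like the generic point of its circle. -/
theorem norm_eval_eq_gaussNorm (F : K[X]) {c z : K} (h : ∀ a ∈ F.roots, ‖a - c‖ ≠ ‖z - c‖) :
    ‖F.eval z‖ = gaussNorm F c ‖z - c‖ := by
  rw [norm_eval_eq, gaussNorm]
  congr 2
  refine Multiset.map_congr rfl fun a ha => ?_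
  have : z - a = (z - c) - (a - c) := by ring
  rw [this, norm_sub_eq_max_of_ne (h a ha).symm, max_comm]

end GaussNorm

/-! ### Root counts for the derivative: Riemann-Hurwitz on a disk. -/

section Count

/-- Roots of an element of norm above `1` make the value group dense; this provides sample radii
inside an annulus. -/
theorem exists_norm_mem_Ioo {K : Type*} [NontriviallyNormedField K] [IsAlgClosed K] {a b : ℝ}
    (ha : 0 ≤ a) (hab : a < b) : ∃ z : K, a < ‖z‖ ∧ ‖z‖ < b := by
  obtain ⟨a', ha', hab'⟩ := exists_between hab
  have ha0 : 0 < a' := ha.trans_lt ha'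
  obtain ⟨u, hu⟩ := NormedField.exists_one_lt_norm K
  have hq : 1 < b / a' := (one_lt_div ha0).2 hab'
  obtain ⟨N, hN⟩ := pow_unbounded_of_one_lt ‖u‖ hq
  have hN0 : N ≠ 0 := by
    rintro rfl
    simp at hN
    exact absurd hu (not_lt.2 hN.le)
  obtain ⟨y, hy⟩ := IsAlgClosed.exists_pow_nat_eq u (Nat.pos_of_ne_zero hN0)
  have hy1 : 1 < ‖y‖ := by
    by_contra h
    rw [← hy, norm_pow] at hu
    exact absurd hu (not_lt.2 (pow_le_one₀ (norm_nonneg _) (not_lt.1 h)))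
  have hy2 : ‖y‖ < b / a' := by
    rw [← hy, norm_pow] at hN
    exact lt_of_pow_lt_pow_left₀ N (by positivity) hN
  obtain ⟨m, hm1, hm2⟩ := exists_mem_Ico_zpow ha0 hy1
  refine ⟨y ^ (m + 1), ?_, ?_⟩
  · rw [norm_zpow]; exact ha'.trans hm2
  · have hy0 : 0 < ‖y‖ := by linarith
    rw [norm_zpow, zpow_add_one₀ hy0.ne']
    calc ‖y‖ ^ m * ‖y‖ ≤ a' * ‖y‖ := by gcongr
      _ < a' * (b / a') := by gcongr
      _ = b := by field_simp

/-- The numerator of the derivative of the rational function `P / Q`. -/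
noncomputable def derivNum {K : Type*} [Field K] (P Q : K[X]) : K[X] :=
  derivative P * Q - P * derivative Q

variable {K : Type*} [NontriviallyNormedField K] [IsUltrametricDist K] [IsAlgClosed K]

/-- `derivNum P Q / (P * Q)` is the difference of the logarithmic derivatives, whose main term is
the difference of the root counts divided by `z - c`. By `hk` this term has norm exactly `1 / ‖z -
c‖` and dominates the error. -/
theorem norm_derivNum_eval {P Q : K[X]} {c z : K} {t t' : ℝ} (ht : 0 ≤ t)
    (hP : NoRoots P c t t') (hQ : NoRoots Q c t t') (hP0 : P ≠ 0) (hQ0 : Q ≠ 0)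
    (hk : ‖(rootsIn P c t : K) - rootsIn Q c t‖ = 1) (hz : t < ‖z - c‖) (hz' : ‖z - c‖ < t') :
    ‖(derivNum P Q).eval z‖ * ‖z - c‖ = ‖P.eval z‖ * ‖Q.eval z‖ := by
  have hne : ∀ {F : K[X]}, F ≠ 0 → NoRoots F c t t' → F.eval z ≠ 0 := by
    intro F hF h h0
    rcases h z ((mem_roots hF).2 h0) with h1 | h1
    · exact absurd hz (not_lt.2 h1)
    · exact absurd hz' (not_lt.2 h1)
  have hPz := hne hP0 hP
  have hQz := hne hQ0 hQ
  have hzc : 0 < ‖z - c‖ := ht.trans_lt hz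
  have h1 := norm_sum_one_div_sub_lt ht hz hz' P.roots hP
  have h2 := norm_sum_one_div_sub_lt ht hz hz' Q.roots hQ
  have e1 := (IsAlgClosed.splits P).eval_derivative_eq_eval_mul_sum hPz
  have e2 := (IsAlgClosed.splits Q).eval_derivative_eq_eval_mul_sum hQz
  set S1 := (P.roots.map fun a => 1 / (z - a)).sum
  set S2 := (Q.roots.map fun a => 1 / (z - a)).sum
  have hsum : ‖(S1 - S2) - ((rootsIn P c t : K) - rootsIn Q c t) / (z - c)‖ < 1 / ‖z - c‖ := by
    have : (S1 - S2) - ((rootsIn P c t : K) - rootsIn Q c t) / (z - c)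
      = (S1 - (rootsIn P c t : K) / (z - c)) - (S2 - (rootsIn Q c t : K) / (z - c)) := by ring
    rw [this]
    exact (norm_sub_le_max' _ _).trans_lt (max_lt h1 h2)
  have hn : ‖((rootsIn P c t : K) - rootsIn Q c t) / (z - c)‖ = 1 / ‖z - c‖ := by
    rw [norm_div, hk]
  rw [← hn] at hsum
  have hfin := norm_eq_of_norm_sub_lt hsum
  have : (derivNum P Q).eval z = P.eval z * Q.eval z * (S1 - S2) := by
    simp only [derivNum, eval_sub, eval_mul, e1, e2]; ring
  rw [this, norm_mul, norm_mul, hfin, hn]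
  field_simp

theorem eq_of_monomial_eq {a b A B : ℝ} {m n : ℕ} (ha : 0 < a) (hab : a < b) (hA : 0 < A)
    (h1 : A * a ^ m = B * a ^ n) (h2 : A * b ^ m = B * b ^ n) : m = n := by
  have hb : 0 < b := ha.trans hab
  have hB : B * a ^ n * b ^ n ≠ 0 := by
    rw [← h1]; positivity
  have hB0 : B ≠ 0 := by rintro rfl; simp at hB
  have h3 : (b / a) ^ m = (b / a) ^ n := by
    rw [div_pow, div_pow, div_eq_div_iff (by positivity) (by positivity)]
    have : A * B * (b ^ m * a ^ n) = A * B * (b ^ n * a ^ m) := by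
      calc A * B * (b ^ m * a ^ n) = (A * b ^ m) * (B * a ^ n) := by ring
        _ = (B * b ^ n) * (A * a ^ m) := by rw [h2, h1]
        _ = _ := by ring
    exact mul_left_cancel₀ (mul_ne_zero hA.ne' hB0) this
  exact pow_right_injective₀ (by positivity) ((one_lt_div ha).2 hab).ne' h3

/-- Riemann-Hurwitz count for a disk on whose boundary annulus `P / Q` has nonzero degree. -/
theorem rootsIn_derivNum {P Q : K[X]} {c : K} {t t' : ℝ} (ht : 0 ≤ t) (htt' : t < t')
    (hP : NoRoots P c t t') (hQ : NoRoots Q c t t') (hT : NoRoots (derivNum P Q) c t t')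
    (hP0 : P ≠ 0) (hQ0 : Q ≠ 0) (hT0 : derivNum P Q ≠ 0)
    (hk : ‖(rootsIn P c t : K) - rootsIn Q c t‖ = 1) :
    rootsIn (derivNum P Q) c t + 1 = rootsIn P c t + rootsIn Q c t := by
  obtain ⟨A, hA, hA'⟩ := exists_gaussNorm_eq hP0 ht hP
  obtain ⟨B, hB, hB'⟩ := exists_gaussNorm_eq hQ0 ht hQ
  obtain ⟨D, hD, hD'⟩ := exists_gaussNorm_eq hT0 ht hT
  -- Each Gauss norm is a monomial in the radius on this annulus, so the pointwise identity compares
  -- two monomials; two sample radii then identify the exponents.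
  have key : ∀ w : K, t < ‖w‖ → ‖w‖ < t' →
      D * ‖w‖ ^ (rootsIn (derivNum P Q) c t + 1)
        = (A * B) * ‖w‖ ^ (rootsIn P c t + rootsIn Q c t) := by
    intro w hw hw'
    have hwc : (w + c) - c = w := by ring
    have hne : ∀ F : K[X], NoRoots F c t t' → ∀ a ∈ F.roots, ‖a - c‖ ≠ ‖(w + c) - c‖ := by
      intro F hF a ha h
      rw [hwc] at h
      rcases hF a ha with h1 | h1 <;> linarith
    have e := norm_derivNum_eval (z := w + c) ht hP hQ hP0 hQ0 hk (by rwa [hwc]) (by rwa [hwc])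
    rw [norm_eval_eq_gaussNorm _ (hne _ hP), norm_eval_eq_gaussNorm _ (hne _ hQ),
      norm_eval_eq_gaussNorm _ (hne _ hT), hwc, hA' _ hw.le hw'.le, hB' _ hw.le hw'.le,
      hD' _ hw.le hw'.le] at e
    rw [pow_succ, pow_add, ← mul_assoc, e]; ring
  obtain ⟨w1, h1, h1'⟩ := exists_norm_mem_Ioo (K := K) ht htt'
  obtain ⟨w2, h2, h2'⟩ := exists_norm_mem_Ioo (K := K) (ht.trans h1.le) h1'
  exact eq_of_monomial_eq (ht.trans_lt h1) h2 hD (key w1 h1 h1') (key w2 (h1.trans h2) h2')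

end Count

/-! ### The size of `P / Q` as a function of the radius. -/

section Radius

/-- On a root-free annulus `gaussQuot` is such a quotient of monomials, so its growth reveals
whether zeros or poles prevail inside. -/
theorem lt_of_monomial_lt {A B s u : ℝ} {m n : ℕ} (hA : 0 < A) (hB : 0 < B) (hs : 0 < s)
    (hsu : s < u) (h : A * s ^ m / (B * s ^ n) < A * u ^ m / (B * u ^ n)) : n < m := by
  by_contra hmn
  obtain ⟨k, rfl⟩ := Nat.exists_eq_add_of_le (not_lt.1 hmn)
  have hu : 0 < u := hs.trans hsu
  have e : ∀ v : ℝ, 0 < v → A * v ^ m / (B * v ^ (m + k)) = A / (B * v ^ k) := by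
    intro v hv; rw [pow_add]; field_simp
  rw [e s hs, e u hu] at h
  refine absurd h (not_lt.2 ?_)
  gcongr

theorem lt_of_monomial_gt {A B s u : ℝ} {m n : ℕ} (hA : 0 < A) (hB : 0 < B) (hs : 0 < s)
    (hsu : s < u) (h : A * u ^ m / (B * u ^ n) < A * s ^ m / (B * s ^ n)) : m < n := by
  have hu : 0 < u := hs.trans hsu
  refine lt_of_monomial_lt hB hA hs hsu ?_
  have := one_div_lt_one_div_of_lt (by positivity) h
  simpa only [one_div_div] using this

variable {K : Type*} [NormedField K]

/-- The absolute value of `P / Q` at the generic point of the disk of centre `c` and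
radius `t`. -/
noncomputable def gaussQuot (P Q : K[X]) (c : K) (t : ℝ) : ℝ :=
  gaussNorm P c t / gaussNorm Q c t

theorem continuousOn_gaussQuot (P : K[X]) {Q : K[X]} (hQ : Q ≠ 0) (c : K) :
    ContinuousOn (gaussQuot P Q c) (Set.Ioi 0) :=
  (continuous_gaussNorm P c).continuousOn.div (continuous_gaussNorm Q c).continuousOn
    fun _ ht => (gaussNorm_pos hQ (Or.inl ht)).ne'

theorem continuousOn_gaussQuot_of_eval_ne_zero (P : K[X]) {Q : K[X]} {c : K}
    (hQ : Q.eval c ≠ 0) : ContinuousOn (gaussQuot P Q c) (Set.Ici 0) := by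
  have hQ0 : Q ≠ 0 := by rintro rfl; simp at hQ
  exact (continuous_gaussNorm P c).continuousOn.div (continuous_gaussNorm Q c).continuousOn
    fun t ht => (gaussNorm_pos hQ0 (Or.inr ⟨ht, hQ⟩)).ne'

/-- On large disks the Gauss norm is the monomial of top degree. -/
theorem exists_gaussNorm_eq_leadingCoeff [IsAlgClosed K] (F : K[X]) (c : K) :
    ∃ t : ℝ, ∀ u, t ≤ u → gaussNorm F c u = ‖F.leadingCoeff‖ * u ^ F.natDegree := by
  have H : ∀ s : Multiset K, ∃ t : ℝ, ∀ a ∈ s, ‖a - c‖ ≤ t := by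
    intro s
    induction s using Multiset.induction_on with
    | empty => exact ⟨1, by simp⟩
    | cons a s ih =>
      obtain ⟨t, h2⟩ := ih
      refine ⟨max t ‖a - c‖, fun b hb => ?_⟩
      rcases Multiset.mem_cons.1 hb with rfl | hb
      exacts [le_max_right _ _, (h2 b hb).trans (le_max_left _ _)]
  obtain ⟨t, h⟩ := H F.roots
  refine ⟨t, fun u hu => ?_⟩
  rw [gaussNorm, (IsAlgClosed.splits F).natDegree_eq_card_roots, ← Multiset.prod_replicate,
    ← Multiset.map_const']
  congr 2
  exact Multiset.map_congr rfl fun a ha => max_eq_right ((h a ha).trans hu)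

/-- If `deg Q < deg P`, then the absolute value of `P / Q` is large on large disks. -/
theorem exists_le_gaussQuot [IsAlgClosed K] {P Q : K[X]} (hdeg : Q.natDegree < P.natDegree)
    (hQ : Q ≠ 0) (c : K) (r : ℝ) : ∃ t > 0, r ≤ gaussQuot P Q c t := by
  have hP : P ≠ 0 := by rintro rfl; simp at hdeg
  obtain ⟨t1, hA'⟩ := exists_gaussNorm_eq_leadingCoeff P c
  obtain ⟨t2, hB'⟩ := exists_gaussNorm_eq_leadingCoeff Q c
  obtain ⟨k, hk⟩ := Nat.exists_eq_add_of_lt hdeg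
  obtain ⟨t0, ht0⟩ : ∃ t0, t0 = max 1 (max t1 t2) := ⟨_, rfl⟩
  have h01 : 1 ≤ t0 := ht0 ▸ le_max_left _ _
  have ht1 : t1 ≤ t0 := ht0 ▸ (le_max_left _ _).trans (le_max_right _ _)
  have ht2 : t2 ≤ t0 := ht0 ▸ (le_max_right _ _).trans (le_max_right _ _)
  have hA : 0 < ‖P.leadingCoeff‖ := norm_pos_iff.2 (leadingCoeff_ne_zero.2 hP)
  have hB : 0 < ‖Q.leadingCoeff‖ := norm_pos_iff.2 (leadingCoeff_ne_zero.2 hQ)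
  set A := ‖P.leadingCoeff‖
  set B := ‖Q.leadingCoeff‖
  -- Beyond all roots the quotient equals `A / B * u ^ (k + 1)`, which is at least `A / B * u`
  -- because `1 ≤ u`; hence the bound `r * B / A`.
  obtain ⟨u, hu⟩ : ∃ u, u = max t0 (r * B / A) := ⟨_, rfl⟩
  have hu0 : t0 ≤ u := hu ▸ le_max_left _ _
  have hu1 : r * B / A ≤ u := hu ▸ le_max_right _ _
  have hupos : 0 < u := by linarith
  refine ⟨u, hupos, ?_⟩
  rw [gaussQuot, hA' u (ht1.trans hu0), hB' u (ht2.trans hu0), hk]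
  have : A * u ^ (Q.natDegree + k + 1) / (B * u ^ Q.natDegree) = A * u ^ (k + 1) / B := by
    rw [add_assoc, pow_add]; field_simp
  rw [this, le_div_iff₀ hB]
  rw [div_le_iff₀ hA] at hu1
  calc r * B ≤ u * A := hu1
    _ ≤ u ^ (k + 1) * A := by
        gcongr; exact le_self_pow₀ (by linarith) (Nat.succ_ne_zero k)
    _ = _ := mul_comm _ _

end Radius

/-! ### Critical radii, holes, and orders of vanishing. -/

section Inverse

variable {K : Type*} [NormedField K]

/-- The form in which tameness is used: root counts are at most `d`, so two distinct ones differ by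
a unit. -/
theorem norm_natCast_sub_natCast {d : ℕ} (htame : ∀ k : ℕ, 1 ≤ k → k ≤ d → ‖(k : K)‖ = 1)
    {m n : ℕ} (hm : m ≤ d) (hn : n ≤ d) (hmn : m ≠ n) : ‖(m : K) - n‖ = 1 := by
  rcases lt_or_gt_of_ne hmn with h | h
  · rw [norm_sub_rev, ← Nat.cast_sub h.le]
    exact htame _ (by omega) (by omega)
  · rw [← Nat.cast_sub h.le]
    exact htame _ (by omega) (by omega)

theorem rootsIn_le_natDegree (F : K[X]) (c : K) (t : ℝ) : rootsIn F c t ≤ F.natDegree :=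
  (Multiset.card_le_card (Multiset.filter_le _ _)).trans (card_roots' F)

/-- At a zero of multiplicity `m` invertible in `K`, `P'` vanishes to order exactly `m - 1`, whereas
`P * Q'` vanishes to order at least `m`. So a zero of `P / Q` contributes at most `-1` to the order
of `derivNum P Q / (P * Q)`. -/
theorem rootMultiplicity_derivNum_lt {P Q : K[X]} {a : K} (hP : P.IsRoot a) (hP0 : P ≠ 0)
    (hQ : Q.eval a ≠ 0) (hT : derivNum P Q ≠ 0)
    (htame : ((P.rootMultiplicity a : ℕ) : K) ≠ 0) :
    (derivNum P Q).rootMultiplicity a < P.rootMultiplicity a := by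
  have hpos := (rootMultiplicity_pos hP0).2 hP
  by_contra hlt
  have hdvd : (X - C a) ^ P.rootMultiplicity a ∣ derivNum P Q :=
    (le_rootMultiplicity_iff hT).1 (not_lt.1 hlt)
  have h2 : (X - C a) ^ P.rootMultiplicity a ∣ derivative P * Q := by
    have := dvd_add hdvd ((pow_rootMultiplicity_dvd P a).mul_right (derivative Q))
    rwa [derivNum, sub_add_cancel] at this
  have hcop : IsCoprime ((X - C a) ^ P.rootMultiplicity a) Q := by
    refine IsCoprime.pow_left ?_
    refine (irreducible_X_sub_C a).coprime_iff_not_dvd.2 fun h => hQ ?_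
    exact dvd_iff_isRoot.1 h
  have h3 := hcop.dvd_of_dvd_mul_right h2
  have hd := derivative_rootMultiplicity_of_root_of_mem_nonZeroDivisors hP
    (mem_nonZeroDivisors_of_ne_zero htame)
  have hP' : derivative P ≠ 0 := by
    intro h0
    obtain ⟨G, hG, hG'⟩ := P.exists_eq_pow_rootMultiplicity_mul_and_not_dvd hP0 a
    set m := P.rootMultiplicity a
    obtain ⟨e, he⟩ := Nat.exists_eq_add_of_le hpos
    rw [hG, derivative_mul, derivative_X_sub_C_pow, he] at h0
    have h4 : (X - C a) ^ e * (C ((m : ℕ) : K) * G + (X - C a) * derivative G) = 0 := by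
      rw [← h0, he, Nat.add_sub_cancel_left]; push_cast; ring
    rcases mul_eq_zero.1 h4 with h5 | h5
    · exact pow_ne_zero _ (X_sub_C_ne_zero a) h5
    · have := congrArg (eval a) h5
      simp only [eval_add, eval_mul, eval_C, eval_sub, eval_X, sub_self, zero_mul, add_zero,
        eval_zero, mul_eq_zero] at this
      exact hG' (dvd_iff_isRoot.2 (this.resolve_left htame))
  have h4 := (le_rootMultiplicity_iff hP').2 h3
  omega

theorem sum_count_filter {α : Type*} [DecidableEq α] (s : Multiset α) (R : Finset α)
    (hR : ∀ a ∈ s, a ∈ R) (p : α → Prop) [DecidablePred p] :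
    ∑ a ∈ R.filter p, (s.count a : ℤ) = (s.filter p).card := by
  rw [← Nat.cast_sum, Nat.cast_inj, ← Multiset.sum_count_eq_card (s := R.filter p)]
  · refine Finset.sum_congr rfl fun a ha => ?_
    rw [Multiset.count_filter_of_pos (Finset.mem_filter.1 ha).2]
  · intro a ha
    rw [Multiset.mem_filter] at ha
    exact Finset.mem_filter.2 ⟨hR a ha.1, ha.2⟩

/-- At the point `c` the absolute value of `P / Q` is attained by small generic radii,
unless `c` is a zero or a pole. -/
theorem norm_div_lt_of_gaussQuot_lt [IsAlgClosed K] {P Q : K[X]} {c : K} (hP : P.eval c ≠ 0)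
    (hQ : Q.eval c ≠ 0) {r x₀ : ℝ} (hx₀ : 0 < x₀)
    (h : ∀ t, 0 < t → t < x₀ → gaussQuot P Q c t < r) : ‖P.eval c / Q.eval c‖ < r := by
  obtain ⟨t1, h1, h1'⟩ := exists_gt_noRoots P c 0
  obtain ⟨t2, h2, h2'⟩ := exists_gt_noRoots Q c 0
  obtain ⟨t, ht0, ht⟩ := exists_between (lt_min hx₀ (lt_min h1 h2))
  have hne : ∀ F : K[X], F.eval c ≠ 0 → NoRoots F c 0 t → gaussNorm F c t = ‖F.eval c‖ := by
    intro F hF hN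
    refine gaussNorm_eq_norm_eval F fun a ha => (hN a ha).resolve_left fun h => hF ?_
    have : a = c := sub_eq_zero.1 (norm_le_zero_iff.1 h)
    exact this ▸ isRoot_of_mem_roots ha
  have := h t ht0 (ht.trans_le (min_le_left _ _))
  rwa [gaussQuot, hne P hP (h1' t (ht.le.trans ((min_le_right _ _).trans (min_le_left _ _)))),
    hne Q hQ (h2' t (ht.le.trans ((min_le_right _ _).trans (min_le_right _ _)))),
    ← norm_div] at this

/-- Near a pole the function is large. -/
theorem exists_le_gaussQuot_of_pole {P Q : K[X]} {c : K} (hP : P.eval c ≠ 0)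
    (hQ : Q.eval c = 0) (hQ0 : Q ≠ 0) {r x₀ : ℝ} (hr : 0 < r) (hx₀ : 0 < x₀) :
    ∃ t, 0 < t ∧ t < x₀ ∧ r ≤ gaussQuot P Q c t := by
  have hP0 : P ≠ 0 := by rintro rfl; simp at hP
  -- The reciprocal `Q / P` is continuous down to radius `0`, where it vanishes.
  have hcont : ContinuousOn (gaussQuot Q P c) (Set.Ici 0) :=
    continuousOn_gaussQuot_of_eval_ne_zero Q hP
  have h0 : gaussQuot Q P c 0 = 0 := by rw [gaussQuot, gaussNorm_eq_zero hQ hQ0, zero_div]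
  have hlim := (hcont 0 (Set.mem_Ici.2 le_rfl)).mono Set.Ioi_subset_Ici_self
  have hev := hlim.eventually (gt_mem_nhds (h0 ▸ (one_div_pos.2 hr)))
  obtain ⟨t, ht, ht'⟩ := (hev.and (Ioo_mem_nhdsGT hx₀)).exists
  refine ⟨t, ht'.1, ht'.2, ?_⟩
  have hpos : 0 < gaussQuot Q P c t :=
    div_pos (gaussNorm_pos hQ0 (Or.inl ht'.1)) (gaussNorm_pos hP0 (Or.inl ht'.1))
  have := (one_div_lt_one_div_of_lt hpos ht).le
  simpa [gaussQuot] using this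

/-- The largest disk around a zero `x` of `P` on which `P / Q` is generically smaller than `r`. -/
theorem exists_critical_radius [IsAlgClosed K] {P Q : K[X]}
    (hdeg : Q.natDegree < P.natDegree) {x : K} (hx : P.eval x = 0)
    (hQx : Q.eval x ≠ 0) {r : ℝ} (hr : 0 < r) :
    ∃ x₀ > 0, r ≤ gaussQuot P Q x x₀ ∧ ∀ t, 0 ≤ t → t < x₀ → gaussQuot P Q x t < r := by
  have hQ0 : Q ≠ 0 := by rintro rfl; simp at hQx
  have hP0 : P ≠ 0 := by rintro rfl; simp at hdeg
  obtain ⟨tl, htl, htl'⟩ := exists_le_gaussQuot hdeg hQ0 x r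
  have hc := continuousOn_gaussQuot_of_eval_ne_zero P hQx
  have hcl : IsClosed (Set.Icc 0 tl ∩ gaussQuot P Q x ⁻¹' Set.Ici r) :=
    (hc.mono Set.Icc_subset_Ici_self).preimage_isClosed_of_isClosed isClosed_Icc isClosed_Ici
  have hcpt := isCompact_Icc.of_isClosed_subset hcl Set.inter_subset_left
  obtain ⟨x₀, hx₀, hmin⟩ := hcpt.exists_isLeast ⟨tl, ⟨htl.le, le_rfl⟩, htl'⟩
  refine ⟨x₀, lt_of_le_of_ne hx₀.1.1 ?_, hx₀.2, fun t h0 h1 => ?_⟩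
  · rintro rfl
    have := hx₀.2
    rw [Set.mem_preimage, gaussQuot, gaussNorm_eq_zero hx hP0, zero_div, Set.mem_Ici] at this
    linarith
  · by_contra h
    exact absurd (hmin ⟨⟨h0, h1.le.trans hx₀.1.2⟩, not_lt.1 h⟩) (not_le.2 h1)

/-- The largest disk around `c`, of radius less than `x₀`, on which `P / Q` is generically at
least `r`. -/
theorem exists_hole_radius {P Q : K[X]} (hQ0 : Q ≠ 0) {c : K} {r x₀ s : ℝ} (hs : s < x₀)
    (hsr : ∀ t, s ≤ t → t < x₀ → gaussQuot P Q c t < r) {t₀ : ℝ} (ht₀ : 0 < t₀)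
    (ht₀' : t₀ < x₀) (hr : r ≤ gaussQuot P Q c t₀) :
    ∃ η, 0 < η ∧ η < x₀ ∧ r ≤ gaussQuot P Q c η ∧
      ∀ t, η < t → t < x₀ → gaussQuot P Q c t < r := by
  have hts : t₀ < s := by
    by_contra h
    exact absurd (hsr t₀ (not_lt.1 h) ht₀') (not_lt.2 hr)
  have hc : ContinuousOn (gaussQuot P Q c) (Set.Icc t₀ s) :=
    (continuousOn_gaussQuot P hQ0 c).mono fun t ht => ht₀.trans_le ht.1
  have hcl : IsClosed (Set.Icc t₀ s ∩ gaussQuot P Q c ⁻¹' Set.Ici r) :=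
    hc.preimage_isClosed_of_isClosed isClosed_Icc isClosed_Ici
  have hcpt := isCompact_Icc.of_isClosed_subset hcl Set.inter_subset_left
  obtain ⟨η, hη, hmax⟩ := hcpt.exists_isGreatest ⟨t₀, ⟨le_rfl, hts.le⟩, hr⟩
  refine ⟨η, ht₀.trans_le hη.1.1, hη.1.2.trans_lt hs, hη.2, fun t h1 h2 => ?_⟩
  rcases le_or_gt s t with h | h
  · exact hsr t h h2
  · by_contra h'
    exact absurd (hmax ⟨⟨hη.1.1.trans h1.le, h.le⟩, not_lt.1 h'⟩) (not_le.2 h1)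

/-- Just beyond `η` the quotient is a monomial whose exponent is the number of zeros minus the
number of poles; since it drops, poles prevail. This makes the Riemann-Hurwitz count available on a
hole. -/
theorem rootsIn_lt_of_gaussQuot_lt {P Q : K[X]} (hP0 : P ≠ 0) (hQ0 : Q ≠ 0) {c : K}
    {r η x₀ : ℝ} (hη : 0 < η) (hηx : η < x₀) (hr : r ≤ gaussQuot P Q c η)
    (h : ∀ t, η < t → t < x₀ → gaussQuot P Q c t < r) : rootsIn P c η < rootsIn Q c η := by
  obtain ⟨t1, h1, h1'⟩ := exists_gt_noRoots P c η
  obtain ⟨t2, h2, h2'⟩ := exists_gt_noRoots Q c η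
  obtain ⟨t, ht0, ht⟩ := exists_between (lt_min hηx (lt_min h1 h2))
  obtain ⟨A, hA, hA'⟩ := exists_gaussNorm_eq hP0 hη.le
    (h1' t (ht.le.trans ((min_le_right _ _).trans (min_le_left _ _))))
  obtain ⟨B, hB, hB'⟩ := exists_gaussNorm_eq hQ0 hη.le
    (h2' t (ht.le.trans ((min_le_right _ _).trans (min_le_right _ _))))
  refine lt_of_monomial_gt hA hB hη ht0 ?_
  rw [← hA' t ht0.le le_rfl, ← hB' t ht0.le le_rfl, ← hA' η le_rfl ht0.le,
    ← hB' η le_rfl ht0.le]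
  exact (h t ht0 (ht.trans_le (min_le_left _ _))).trans_le hr

end Inverse

/-! ### Riemann-Hurwitz for the preimage of a disk, and its radius. -/

section Inverse

variable {K : Type*} [NontriviallyNormedField K] [IsUltrametricDist K] [IsAlgClosed K]

/-- The sum, over the points of a closed disk, of the order of `derivNum P Q / (P * Q)`. -/
theorem sum_order_closedBall {P Q : K[X]} (hP0 : P ≠ 0) (hQ0 : Q ≠ 0)
    (hT0 : derivNum P Q ≠ 0) {d : ℕ} (htame : ∀ k : ℕ, 1 ≤ k → k ≤ d → ‖(k : K)‖ = 1)
    (hPd : P.natDegree ≤ d) (hQd : Q.natDegree ≤ d) [DecidableEq K] (R : Finset K)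
    (hPR : ∀ a ∈ P.roots, a ∈ R) (hQR : ∀ a ∈ Q.roots, a ∈ R)
    (hTR : ∀ a ∈ (derivNum P Q).roots, a ∈ R) {c : K} {t : ℝ} (ht : 0 ≤ t)
    (hne : rootsIn P c t ≠ rootsIn Q c t) :
    ∑ a ∈ R.filter (fun a => ‖a - c‖ ≤ t), (((derivNum P Q).roots.count a : ℤ)
      - P.roots.count a - Q.roots.count a) = -1 := by
  obtain ⟨t1, h1, h1'⟩ := exists_gt_noRoots P c t
  obtain ⟨t2, h2, h2'⟩ := exists_gt_noRoots Q c t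
  obtain ⟨t3, h3, h3'⟩ := exists_gt_noRoots (derivNum P Q) c t
  have hcount := rootsIn_derivNum ht (lt_min h1 (lt_min h2 h3)) (h1' _ (min_le_left _ _))
    (h2' _ ((min_le_right _ _).trans (min_le_left _ _)))
    (h3' _ ((min_le_right _ _).trans (min_le_right _ _))) hP0 hQ0 hT0
    (norm_natCast_sub_natCast htame ((rootsIn_le_natDegree _ _ _).trans hPd)
      ((rootsIn_le_natDegree _ _ _).trans hQd) hne)
  rw [Finset.sum_sub_distrib, Finset.sum_sub_distrib, sum_count_filter _ _ hTR,
    sum_count_filter _ _ hPR, sum_count_filter _ _ hQR]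
  unfold rootsIn at hcount
  omega

/-- If `P / Q` has no critical point outside the fibre of `0` with value in the disk
`|w| < r`, then it has neither zeros nor poles, apart from `x`, in the largest disk around
its unramified zero `x` on which it is generically smaller than `r`. -/
theorem no_zeros_poles {P Q : K[X]} (hdeg : Q.natDegree < P.natDegree)
    (htame : ∀ k : ℕ, 1 ≤ k → k ≤ P.natDegree → ‖(k : K)‖ = 1)
    (hcop : ∀ z, P.eval z = 0 → Q.eval z ≠ 0) {x : K} (hx : P.eval x = 0)
    (hTx : (derivNum P Q).eval x ≠ 0) {r : ℝ} (hr : 0 < r)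
    (hcrit : ∀ c, Q.eval c ≠ 0 → (derivNum P Q).eval c = 0 → ‖P.eval c / Q.eval c‖ < r →
      P.eval c = 0) {x₀ : ℝ} (hx₀ : 0 < x₀) (hx₀r : r ≤ gaussQuot P Q x x₀)
    (hlt : ∀ t, 0 ≤ t → t < x₀ → gaussQuot P Q x t < r) {z : K} (hz : ‖z - x‖ < x₀) :
    Q.eval z ≠ 0 ∧ (z ≠ x → P.eval z ≠ 0) := by
  -- Remove from the open disk of radius `x₀` its holes, the maximal closed disks on which `P / Q`
  -- is generically at least `r`. The orders `δ` of `derivNum P Q / (P * Q)` add up to `-1` over the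
  -- open disk and over each hole, hence to (number of holes) `- 1` over the remaining points. There
  -- no `δ` is positive, and `δ x ≤ -1`. So there is no hole, hence no pole, and no second zero.
  -- Only the finite set `R` of roots matters, so only holes meeting `R` are counted.
  classical
  have hQx := hcop x hx
  have hQ0 : Q ≠ 0 := by rintro rfl; simp at hQx
  have hP0 : P ≠ 0 := by rintro rfl; simp at hdeg
  have hT0 : derivNum P Q ≠ 0 := by intro h; simp [h] at hTx
  obtain ⟨R, hR⟩ : ∃ R, R = (P.roots + Q.roots + (derivNum P Q).roots).toFinset := ⟨_, rfl⟩
  have hPR : ∀ a ∈ P.roots, a ∈ R := fun a ha => by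
    rw [hR, Multiset.mem_toFinset]; simp only [Multiset.mem_add]; tauto
  have hQR : ∀ a ∈ Q.roots, a ∈ R := fun a ha => by
    rw [hR, Multiset.mem_toFinset]; simp only [Multiset.mem_add]; tauto
  have hTR : ∀ a ∈ (derivNum P Q).roots, a ∈ R := fun a ha => by
    rw [hR, Multiset.mem_toFinset]; simp only [Multiset.mem_add]; tauto
  obtain ⟨δ, hδ⟩ : ∃ δ : K → ℤ, δ = fun a => ((derivNum P Q).roots.count a : ℤ)
      - P.roots.count a - Q.roots.count a := ⟨_, rfl⟩
  have hsum : ∀ c t, 0 ≤ t → rootsIn P c t ≠ rootsIn Q c t →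
      ∑ a ∈ R.filter (fun a => ‖a - c‖ ≤ t), δ a = -1 := by
    intro c t ht hne
    rw [hδ]
    exact sum_order_closedBall hP0 hQ0 hT0 htame le_rfl hdeg.le R hPR hQR hTR ht hne
  -- the outer disk
  have houter : ∑ a ∈ R.filter (fun a => ‖a - x‖ < x₀), δ a = -1 := by
    obtain ⟨t1, h10, h1, h1'⟩ := exists_lt_noRoots (P * Q * derivNum P Q) x hx₀
    have hmem : ∀ F : K[X], F ∣ P * Q * derivNum P Q → NoRoots F x t1 x₀ := by
      intro F hF a ha
      exact h1' t1 le_rfl a (Multiset.mem_of_le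
        (roots.le_of_dvd (mul_ne_zero (mul_ne_zero hP0 hQ0) hT0) hF) ha)
    have hnP := hmem P (Dvd.intro _ (mul_assoc _ _ _).symm)
    have hnQ := hmem Q ((dvd_mul_left Q P).mul_right _)
    have hnT := hmem _ (dvd_mul_left (derivNum P Q) (P * Q))
    -- The quotient grows as the radius approaches `x₀`, so zeros prevail over poles and the count
    -- applies.
    have hNN : rootsIn Q x t1 < rootsIn P x t1 := by
      obtain ⟨A, hA, hA'⟩ := exists_gaussNorm_eq hP0 h10 hnP
      obtain ⟨B, hB, hB'⟩ := exists_gaussNorm_eq hQ0 h10 hnQ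
      obtain ⟨t, ht, ht'⟩ := exists_between h1
      refine lt_of_monomial_lt hA hB (h10.trans_lt ht) ht' ?_
      rw [← hA' t ht.le ht'.le, ← hB' t ht.le ht'.le, ← hA' _ h1.le le_rfl,
        ← hB' _ h1.le le_rfl]
      exact (hlt t (h10.trans ht.le) ht').trans_le hx₀r
    rw [← hsum x t1 h10 hNN.ne']
    refine Finset.sum_congr (Finset.filter_congr fun a ha => ?_) fun _ _ => rfl
    refine ⟨fun h => ?_, fun h => h.trans_lt h1⟩
    rw [hR, Multiset.mem_toFinset] at ha
    have : ‖a - x‖ ≤ t1 ∨ x₀ ≤ ‖a - x‖ := by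
      rcases Multiset.mem_add.1 ha with ha | ha
      · rcases Multiset.mem_add.1 ha with ha | ha
        exacts [hnP a ha, hnQ a ha]
      · exact hnT a ha
    exact this.resolve_right (not_le.2 h)
  -- the holes
  obtain ⟨bad, hbad⟩ : ∃ bad : K → Prop, bad = fun c =>
    ∃ t, 0 < t ∧ t < x₀ ∧ r ≤ gaussQuot P Q c t := ⟨_, rfl⟩
  have hholes : ∀ c, ∃ η, ‖c - x‖ < x₀ → bad c → 0 < η ∧ η < x₀ ∧ r ≤ gaussQuot P Q c η ∧
      ∀ t, η < t → t < x₀ → gaussQuot P Q c t < r := by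
    intro c
    by_cases h : ‖c - x‖ < x₀ ∧ bad c
    · obtain ⟨h1, h2⟩ := h
      rw [hbad] at h2
      obtain ⟨t, ht0, ht1, ht2⟩ := h2
      obtain ⟨η, hη⟩ := exists_hole_radius hQ0 h1 (fun t h3 h4 => by
        rw [gaussQuot, gaussNorm_congr P h3, gaussNorm_congr Q h3]
        exact hlt t ((norm_nonneg _).trans h3) h4) ht0 ht1 ht2
      exact ⟨η, fun _ _ => hη⟩
    -- `0` is a dummy radius for points outside the disk or in no hole.
    · exact ⟨0, fun h1 h2 => absurd ⟨h1, h2⟩ h⟩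
  choose η hη using hholes
  -- A hole has the same radius seen from any of its points; hence the holes partition the bad
  -- points.
  have hdisk : ∀ c a, ‖c - x‖ < x₀ → bad c → ‖a - c‖ ≤ η c →
      ‖a - x‖ < x₀ ∧ bad a ∧ η a = η c := by
    intro c a hc hbc hac
    obtain ⟨h1, h2, h3, h4⟩ := hη c hc hbc
    have hcongr : ∀ t, η c ≤ t → gaussQuot P Q a t = gaussQuot P Q c t := fun t ht => by
      rw [gaussQuot, gaussQuot, gaussNorm_congr P (hac.trans ht), gaussNorm_congr Q (hac.trans ht)]
    have hax : ‖a - x‖ < x₀ := by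
      have : a - x = (a - c) + (c - x) := by ring
      rw [this]
      exact (IsUltrametricDist.norm_add_le_max _ _).trans_lt (max_lt (hac.trans_lt h2) hc)
    have hba : bad a := by
      rw [hbad]; exact ⟨η c, h1, h2, (hcongr _ le_rfl).symm ▸ h3⟩
    obtain ⟨g1, g2, g3, g4⟩ := hη a hax hba
    refine ⟨hax, hba, le_antisymm ?_ ?_⟩
    · by_contra h
      have := h4 _ (not_le.1 h) g2
      rw [← hcongr _ (not_le.1 h).le] at this
      linarith
    · by_contra h
      have := g4 _ (not_le.1 h) h2
      rw [hcongr _ le_rfl] at this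
      linarith
  obtain ⟨B, hB⟩ : ∃ B, B = (R.filter (fun a => ‖a - x‖ < x₀)).filter bad := ⟨_, rfl⟩
  obtain ⟨G, hG⟩ : ∃ G, G = (R.filter (fun a => ‖a - x‖ < x₀)).filter (fun a => ¬ bad a) :=
    ⟨_, rfl⟩
  obtain ⟨H, hH⟩ : ∃ H : K → Set K, H = fun c => Metric.closedBall c (η c) := ⟨_, rfl⟩
  have hBmem : ∀ a, a ∈ B ↔ a ∈ R ∧ ‖a - x‖ < x₀ ∧ bad a := by
    intro a; rw [hB, Finset.mem_filter, Finset.mem_filter, and_assoc]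
  have hGmem : ∀ a, a ∈ G ↔ a ∈ R ∧ ‖a - x‖ < x₀ ∧ ¬ bad a := by
    intro a; rw [hG, Finset.mem_filter, Finset.mem_filter, and_assoc]
  have hsplit : ∑ a ∈ B, δ a + ∑ a ∈ G, δ a = -1 := by
    rw [← houter, hB, hG]; exact Finset.sum_filter_add_sum_filter_not _ _ _
  -- Group the bad points by the hole `H` containing them; each fibre sums to `-1`.
  have hBsum : ∑ a ∈ B, δ a = -((B.image H).card : ℤ) := by
    rw [← Finset.sum_fiberwise_of_maps_to (g := H) (t := B.image H)
      (fun a ha => Finset.mem_image_of_mem H ha)]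
    rw [Finset.sum_congr rfl (g := fun _ => (-1 : ℤ)), Finset.sum_const]
    · simp
    · intro S hS
      obtain ⟨c, hc, rfl⟩ := Finset.mem_image.1 hS
      obtain ⟨hcR, hcx, hcb⟩ := (hBmem c).1 hc
      obtain ⟨h1, h2, h3, h4⟩ := hη c hcx hcb
      rw [← hsum c (η c) h1.le (rootsIn_lt_of_gaussQuot_lt hP0 hQ0 h1 h2 h3 h4).ne]
      refine Finset.sum_congr ?_ fun _ _ => rfl
      ext a
      rw [Finset.mem_filter, Finset.mem_filter, hBmem]
      constructor
      · rintro ⟨⟨haR, hax, hab⟩, haH⟩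
        refine ⟨haR, ?_⟩
        have : a ∈ H a := by
          rw [hH]; exact Metric.mem_closedBall_self (hη a hax hab).1.le
        rw [haH, hH] at this
        rwa [← dist_eq_norm]
      · rintro ⟨haR, hac⟩
        obtain ⟨h5, h6, h7⟩ := hdisk c a hcx hcb hac
        refine ⟨⟨haR, h5, h6⟩, ?_⟩
        rw [hH]
        simp only [h7]
        exact IsUltrametricDist.closedBall_eq_of_mem (by simpa [dist_eq_norm] using hac) |>.symm
  -- the remaining points
  have hgood : ∀ a ∈ G, Q.eval a ≠ 0 ∧ δ a ≤ 0 ∧ (P.eval a = 0 → δ a ≤ -1) := by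
    intro a ha
    obtain ⟨haR, hax, hab⟩ := (hGmem a).1 ha
    rw [hbad] at hab
    push Not at hab
    have hQa : Q.eval a ≠ 0 := by
      intro h0
      obtain ⟨t, ht1, ht2, ht3⟩ := exists_le_gaussQuot_of_pole (P := P)
        (fun h => hcop a h h0) h0 hQ0 hr hx₀
      exact absurd ht3 (not_le.2 (hab t ht1 ht2))
    have hδQ : Q.roots.count a = 0 :=
      Multiset.count_eq_zero.2 fun h => hQa (isRoot_of_mem_roots h)
    have hzero : P.eval a = 0 → δ a ≤ -1 := by
      intro h0
      have h1 : P.rootMultiplicity a ≤ P.natDegree := by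
        rw [← count_roots]
        exact (Multiset.count_le_card _ _).trans (card_roots' P)
      have hm := rootMultiplicity_derivNum_lt h0 hP0 hQa hT0 (by
        rw [← norm_pos_iff, htame _ ((rootMultiplicity_pos hP0).2 h0) h1]
        exact one_pos)
      rw [hδ]
      simp only [count_roots] at hδQ ⊢
      omega
    refine ⟨hQa, ?_, hzero⟩
    by_cases h0 : P.eval a = 0
    · have := hzero h0; omega
    · have hTa : (derivNum P Q).eval a ≠ 0 := fun h =>
        h0 (hcrit a hQa h (norm_div_lt_of_gaussQuot_lt h0 hQa hx₀ hab))
      have h1 : (derivNum P Q).roots.count a = 0 :=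
        Multiset.count_eq_zero.2 fun h => hTa (isRoot_of_mem_roots h)
      rw [hδ]
      simp only [h1, hδQ]
      omega
  have hxG : x ∈ G := by
    refine (hGmem x).2 ⟨hPR x ((mem_roots hP0).2 hx), by simpa using hx₀, ?_⟩
    rw [hbad]
    rintro ⟨t, h1, h2, h3⟩
    exact absurd (hlt t h1.le h2) (not_lt.2 h3)
  have hGle : ∀ S ⊆ G, ∑ a ∈ G, δ a ≤ ∑ a ∈ S, δ a := by
    intro S hS
    rw [← Finset.sum_sdiff hS]
    have : ∑ a ∈ G \ S, δ a ≤ 0 :=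
      Finset.sum_nonpos fun a ha => (hgood a (Finset.mem_sdiff.1 ha).1).2.1
    omega
  have hx1 := (hgood x hxG).2.2 hx
  have hGx := hGle {x} (by simpa using hxG)
  rw [Finset.sum_singleton] at hGx
  -- The sum over `G` is (number of holes) `- 1`, yet at most `δ x ≤ -1`.
  have hBempty : B = ∅ := by
    rw [← Finset.image_eq_empty (f := H), ← Finset.card_eq_zero]
    omega
  have hQz : Q.eval z ≠ 0 := by
    intro h0
    by_cases hbz : bad z
    · have : z ∈ B := (hBmem z).2 ⟨hQR z ((mem_roots hQ0).2 h0), hz, hbz⟩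
      rw [hBempty] at this
      exact absurd this (Finset.notMem_empty z)
    · exact (hgood z ((hGmem z).2 ⟨hQR z ((mem_roots hQ0).2 h0), hz, hbz⟩)).1 h0
  refine ⟨hQz, fun hzx h0 => ?_⟩
  have hzR := hPR z ((mem_roots hP0).2 h0)
  have hzG : z ∈ G := by
    refine (hGmem z).2 ⟨hzR, hz, fun hbz => ?_⟩
    have : z ∈ B := (hBmem z).2 ⟨hzR, hz, hbz⟩
    rw [hBempty] at this
    exact absurd this (Finset.notMem_empty z)
  -- A second zero would push the sum over `G` down to `-2`, but it equals `-1`.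
  have hz1 := (hgood z hzG).2.2 h0
  have hGz := hGle {z, x} (by
    intro a ha
    rcases Finset.mem_insert.1 ha with rfl | ha
    · exact hzG
    · rw [Finset.mem_singleton.1 ha]; exact hxG)
  rw [Finset.sum_pair hzx] at hGz
  omega

/-- If `P / Q` has no critical point outside the fibre of `0` with value in the disk
`|w| < r`, then the punctured disk of radius `r / |(P / Q)'(x)|` around an unramified zero `x`
is mapped to the punctured disk `0 < |w| < r`. -/
theorem norm_div_lt_of_no_critical_value {P Q : K[X]} (hdeg : Q.natDegree < P.natDegree)
    (htame : ∀ k : ℕ, 1 ≤ k → k ≤ P.natDegree → ‖(k : K)‖ = 1)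
    (hcop : ∀ z, P.eval z = 0 → Q.eval z ≠ 0) {x : K} (hx : P.eval x = 0)
    (hTx : (derivNum P Q).eval x ≠ 0) {r : ℝ} (hr : 0 < r)
    (hcrit : ∀ c, Q.eval c ≠ 0 → (derivNum P Q).eval c = 0 → ‖P.eval c / Q.eval c‖ < r →
      P.eval c = 0) {z : K} (hzx : z ≠ x)
    (hz : ‖z - x‖ * ‖(derivNum P Q).eval x / Q.eval x ^ 2‖ < r) :
    Q.eval z ≠ 0 ∧ P.eval z ≠ 0 ∧ ‖P.eval z / Q.eval z‖ < r := by
  have hQx := hcop x hx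
  have hQ0 : Q ≠ 0 := by rintro rfl; simp at hQx
  have hP0 : P ≠ 0 := by rintro rfl; simp at hdeg
  obtain ⟨x₀, hx₀, hx₀r, hlt⟩ := exists_critical_radius hdeg hx hQx hr
  have hno : ∀ z : K, ‖z - x‖ < x₀ → Q.eval z ≠ 0 ∧ (z ≠ x → P.eval z ≠ 0) := fun z hz =>
    no_zeros_poles hdeg htame hcop hx hTx hr hcrit hx₀ hx₀r hlt hz
  obtain ⟨G, hG⟩ := dvd_iff_isRoot.2 hx
  have hG0 : G ≠ 0 := by rintro rfl; simp [hG] at hP0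
  have hTG : (derivNum P Q).eval x = G.eval x * Q.eval x := by
    simp [derivNum, hG]
  have hGx : G.eval x ≠ 0 := by
    intro h; rw [hTG, h, zero_mul] at hTx; exact hTx rfl
  -- Without poles and other zeros, `Q` and `P / (X - x)` have constant absolute value on the disk,
  -- so `P / Q` scales by its derivative at `x`. As the value at `x₀` is at least `r`, the disk of
  -- radius `r / |(P / Q)'(x)|` fits inside.
  have hradius : ‖(derivNum P Q).eval x / Q.eval x ^ 2‖ * x₀ = gaussQuot P Q x x₀ := by
    have h1 : gaussNorm Q x x₀ = ‖Q.eval x‖ := by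
      refine gaussNorm_eq_norm_eval Q fun a ha => ?_
      by_contra h
      exact (hno a (not_le.1 h)).1 (isRoot_of_mem_roots ha)
    have h2 : gaussNorm G x x₀ = ‖G.eval x‖ := by
      refine gaussNorm_eq_norm_eval G fun a ha => ?_
      by_contra h
      have hax : a ≠ x := by
        rintro rfl; exact hGx (isRoot_of_mem_roots ha)
      refine (hno a (not_le.1 h)).2 hax ?_
      rw [hG, eval_mul, show G.eval a = 0 from isRoot_of_mem_roots ha, mul_zero]
    have h3 : gaussNorm P x x₀ = x₀ * gaussNorm G x x₀ := by
      have hP0' := hP0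
      rw [hG] at hP0'
      rw [gaussNorm, gaussNorm, hG, roots_mul hP0', leadingCoeff_mul, leadingCoeff_X_sub_C,
        roots_X_sub_C, one_mul, Multiset.map_add, Multiset.prod_add]
      simp only [Multiset.map_singleton, Multiset.prod_singleton, sub_self, norm_zero,
        max_eq_right hx₀.le]
      ring
    rw [gaussQuot, h3, h1, h2, hTG, norm_div, norm_mul, norm_pow]
    have : ‖Q.eval x‖ ≠ 0 := norm_ne_zero_iff.2 hQx
    field_simp
  have hzx₀ : ‖z - x‖ < x₀ := by
    by_contra h
    have := mul_le_mul_of_nonneg_right (not_lt.1 h)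
      (norm_nonneg ((derivNum P Q).eval x / Q.eval x ^ 2))
    rw [mul_comm, hradius] at this
    linarith
  obtain ⟨h1, h2⟩ := hno z hzx₀
  refine ⟨h1, h2 hzx, ?_⟩
  have hzpos : 0 < ‖z - x‖ := norm_pos_iff.2 (sub_ne_zero.2 hzx)
  have hnP : ∀ a ∈ P.roots, ‖a - x‖ ≠ ‖z - x‖ := by
    intro a ha h
    refine (hno a (h ▸ hzx₀)).2 ?_ (isRoot_of_mem_roots ha)
    rintro rfl
    rw [sub_self, norm_zero] at h
    exact hzpos.ne h
  have hnQ : ∀ a ∈ Q.roots, ‖a - x‖ ≠ ‖z - x‖ := fun a ha h =>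
    (hno a (h ▸ hzx₀)).1 (isRoot_of_mem_roots ha)
  rw [norm_div, norm_eval_eq_gaussNorm P hnP, norm_eval_eq_gaussNorm Q hnQ]
  exact hlt _ (norm_nonneg _) hzx₀

end Inverse

/-! ### Dynamics of a rational function fixing `∞`. -/

section Affine

open Filter Topology

/-- The function `z ↦ P(z) / Q(z)`. -/
noncomputable def ratEval {K : Type*} [Field K] (P Q : K[X]) (z : K) : K := P.eval z / Q.eval z

/-- The orbit of `z` under `P / Q` meets the punctured disk `0 < |w - g| < r`, without
meeting a pole before. -/
def EntersPuncturedDisk {K : Type*} [NormedField K] (P Q : K[X]) (g : K) (r : ℝ) (z : K) :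
    Prop :=
  ∃ j : ℕ, (∀ i < j, Q.eval ((ratEval P Q)^[i] z) ≠ 0) ∧
    0 < ‖(ratEval P Q)^[j] z - g‖ ∧ ‖(ratEval P Q)^[j] z - g‖ < r

section Basic

variable {K : Type*} [NontriviallyNormedField K] {P Q : K[X]}

theorem hasDerivAt_ratEval {z : K} (hz : Q.eval z ≠ 0) :
    HasDerivAt (ratEval P Q) ((derivNum P Q).eval z / Q.eval z ^ 2) z := by
  have := (P.hasDerivAt z).div (Q.hasDerivAt z) hz
  rw [derivNum, eval_sub, eval_mul, eval_mul]
  exact this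

theorem EntersPuncturedDisk.of_apply {g z : K} {r : ℝ} (hz : Q.eval z ≠ 0)
    (h : EntersPuncturedDisk P Q g r (ratEval P Q z)) : EntersPuncturedDisk P Q g r z := by
  obtain ⟨j, h1, h2, h3⟩ := h
  refine ⟨j + 1, fun i hi => ?_, by simpa using h2, by simpa using h3⟩
  cases i with
  | zero => simpa using hz
  | succ i => simpa using h1 i (by omega)

theorem differentiableAt_iterate_ratEval {g : K} (i : ℕ)
    (h : ∀ j < i, Q.eval ((ratEval P Q)^[j] g) ≠ 0) : DifferentiableAt K (ratEval P Q)^[i] g := by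
  induction i with
  | zero => exact differentiableAt_id
  | succ i ih =>
    rw [Function.iterate_succ']
    exact DifferentiableAt.comp g (hasDerivAt_ratEval (h i (Nat.lt_succ_self i))).differentiableAt
      (ih fun j hj => h j (Nat.lt_succ_of_lt hj))

theorem eventually_iterate_ratEval_ne {g : K} {n : ℕ}
    (h : ∀ j < n, Q.eval ((ratEval P Q)^[j] g) ≠ 0) :
    ∀ᶠ z in 𝓝 g, ∀ i < n, Q.eval ((ratEval P Q)^[i] z) ≠ 0 := by
  have h1 : ∀ i ∈ Finset.range n, ∀ᶠ z in 𝓝 g, Q.eval ((ratEval P Q)^[i] z) ≠ 0 := by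
    intro i hi
    have hi' := Finset.mem_range.1 hi
    have : ContinuousAt (fun z => Q.eval ((ratEval P Q)^[i] z)) g :=
      Q.continuous.continuousAt.comp
        (differentiableAt_iterate_ratEval i fun j hj => h j (hj.trans hi')).continuousAt
    exact this.eventually_ne (h i hi')
  filter_upwards [(Finset.eventually_all _).2 h1] with z hz i hi using hz i (Finset.mem_range.2 hi)

/-- Once the error in the linear approximation is at most `‖μ‖ / 2 * ‖z - g‖`, the ultrametric
inequality turns the approximation into an exact equality of norms. -/
theorem exists_contracting_disk [IsUltrametricDist K] {g μ : K} {n : ℕ}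
    (hper : (ratEval P Q)^[n] g = g) (hpole : ∀ j, Q.eval ((ratEval P Q)^[j] g) ≠ 0)
    (hμ : HasDerivAt (ratEval P Q)^[n] μ g) (hμ0 : 0 < ‖μ‖) :
    ∃ r > 0, ∀ z, ‖z - g‖ < r → (∀ i < n, Q.eval ((ratEval P Q)^[i] z) ≠ 0) ∧
      ‖(ratEval P Q)^[n] z - g‖ = ‖μ‖ * ‖z - g‖ := by
  have h2 := (hasDerivAt_iff_isLittleO.1 hμ).def (half_pos hμ0)
  have h3 := (eventually_iterate_ratEval_ne (n := n) fun j _ => hpole j).and h2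
  obtain ⟨r, hr, hr'⟩ := Metric.eventually_nhds_iff.1 h3
  refine ⟨r, hr, fun z hz => ?_⟩
  obtain ⟨h4, h5⟩ := hr' (by rwa [dist_eq_norm])
  refine ⟨h4, ?_⟩
  rw [hper, smul_eq_mul] at h5
  rcases eq_or_ne z g with rfl | hzg
  · simp [hper]
  have hpos : 0 < ‖z - g‖ := norm_pos_iff.2 (sub_ne_zero.2 hzg)
  rw [mul_comm, ← norm_mul]
  refine norm_eq_of_norm_sub_lt (h5.trans_lt ?_)
  rw [norm_mul, mul_comm]
  exact mul_lt_mul_of_pos_left (half_lt_self hμ0) hpos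

/-- The points whose orbit enters a small punctured disk around `g` are strictly attracted. -/
theorem EntersPuncturedDisk.strictly_attracted {g μ : K} {n : ℕ} (hn : 1 ≤ n)
    (hper : (ratEval P Q)^[n] g = g) (hpole : ∀ j, Q.eval ((ratEval P Q)^[j] g) ≠ 0)
    (hμ0 : 0 < ‖μ‖) (hμ1 : ‖μ‖ < 1) {r : ℝ}
    (hr : ∀ z, ‖z - g‖ < r → (∀ i < n, Q.eval ((ratEval P Q)^[i] z) ≠ 0) ∧
      ‖(ratEval P Q)^[n] z - g‖ = ‖μ‖ * ‖z - g‖)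
    {z : K} (hz : EntersPuncturedDisk P Q g r z) :
    (∀ l, Q.eval ((ratEval P Q)^[l] z) ≠ 0) ∧ (∀ l, (ratEval P Q)^[l] z ≠ g) ∧
      ∃ k < n, Tendsto (fun m => (ratEval P Q)^[n * m] z) atTop
        (𝓝 ((ratEval P Q)^[k] g)) := by
  obtain ⟨j, hj, hpos, hlt⟩ := hz
  set f := ratEval P Q with hf
  have horb : ∀ m, ‖f^[n * m] (f^[j] z) - g‖ = ‖μ‖ ^ m * ‖f^[j] z - g‖ ∧
      ‖f^[n * m] (f^[j] z) - g‖ < r := by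
    intro m
    induction m with
    | zero => simpa using hlt
    | succ m ih =>
      have h1 := (hr _ ih.2).2
      rw [Nat.mul_succ, Nat.add_comm, Function.iterate_add_apply]
      refine ⟨by rw [h1, ih.1]; ring, ?_⟩
      rw [h1]
      exact (mul_le_of_le_one_left (norm_nonneg _) hμ1.le).trans_lt ih.2
  refine ⟨fun l => ?_, fun l hl => ?_, ?_⟩
  · rcases lt_or_ge l j with h | h
    · exact hj l h
    · have e : l = (l - j) % n + (n * ((l - j) / n) + j) := by
        have := Nat.mod_add_div (l - j) n; omega
      rw [e, Function.iterate_add_apply, Function.iterate_add_apply]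
      exact (hr _ (horb _).2).1 _ (Nat.mod_lt _ hn)
  -- If the orbit hit `g`, then at the later time `n * l + j` it would be at a point of the cycle,
  -- fixed by `f^[n]`, inside the punctured disk where `f^[n]` strictly contracts distances to `g`.
  · obtain ⟨e, he⟩ : ∃ e, e + l = n * l + j := by
      refine ⟨n * l + j - l, ?_⟩
      have : l ≤ n * l := Nat.le_mul_of_pos_left l hn
      omega
    have h1 : f^[n * l] (f^[j] z) = f^[e] g := by
      rw [← Function.iterate_add_apply, ← he, Function.iterate_add_apply, hl]
    have h2 := (horb l)
    rw [h1] at h2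
    have h3 := (hr _ h2.2).2
    rw [← Function.iterate_add_apply, Nat.add_comm, Function.iterate_add_apply, hper] at h3
    have h4 : 0 < ‖f^[e] g - g‖ := by rw [h2.1]; positivity
    nlinarith
  -- `k` is the residue of `-j` modulo `n`: waiting `k` steps after entering the disk makes the
  -- total time a multiple of `n`.
  · obtain ⟨k, hk, M, hM⟩ : ∃ k < n, ∃ M, k + j = n * M := by
      refine ⟨(n - j % n) % n, Nat.mod_lt _ hn, ?_⟩
      have : n ∣ (n - j % n) % n + j := by
        rw [Nat.dvd_iff_mod_eq_zero, Nat.add_mod, Nat.mod_mod, ← Nat.add_mod]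
        have h1 := Nat.mod_lt j hn
        have h2 := Nat.mod_add_div j n
        have h3 : n - j % n + j = n + n * (j / n) := by omega
        rw [h3]; simp
      exact this
    refine ⟨k, hk, ?_⟩
    have hlim : Tendsto (fun m => f^[n * m] (f^[j] z)) atTop (𝓝 g) := by
      rw [tendsto_iff_norm_sub_tendsto_zero]
      simp only [(horb _).1]
      simpa using (tendsto_pow_atTop_nhds_zero_of_lt_one (norm_nonneg μ) hμ1).mul_const
        ‖f^[j] z - g‖
    have hlim2 :=
      (differentiableAt_iterate_ratEval k fun i _ => hpole i).continuousAt.tendsto.comp hlim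
    rw [← tendsto_add_atTop_iff_nat M]
    refine hlim2.congr fun m => ?_
    rw [Function.comp_apply, ← hf, ← Function.iterate_add_apply, ← Function.iterate_add_apply]
    congr 1
    rw [Nat.mul_add, ← hM]; ring_nf

end Basic

variable {K : Type*} [NontriviallyNormedField K] [IsUltrametricDist K] [IsAlgClosed K]
  {P Q : K[X]}

/-- If no critical value lies in the region strictly attracted to `g`, then the backward
orbit of a punctured disk around `g`, along the cycle, contains arbitrarily large disks. -/
theorem entersPuncturedDisk_of_norm_lt (hdeg : Q.natDegree < P.natDegree)
    (htame : ∀ k : ℕ, 1 ≤ k → k ≤ P.natDegree → ‖(k : K)‖ = 1)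
    (hcop : ∀ z, P.eval z = 0 → Q.eval z ≠ 0) {g μ : K} {n : ℕ} (hn : 1 ≤ n)
    (hper : (ratEval P Q)^[n] g = g) (hpole : ∀ j, Q.eval ((ratEval P Q)^[j] g) ≠ 0)
    (hcycle : ∀ j, (derivNum P Q).eval ((ratEval P Q)^[j] g) ≠ 0)
    (hμ : HasDerivAt (ratEval P Q)^[n] μ g) {r : ℝ} (hr : 0 < r)
    (hcrit : ∀ c, Q.eval c ≠ 0 → (derivNum P Q).eval c = 0 →
      ¬ EntersPuncturedDisk P Q g r (ratEval P Q c)) (k : ℕ) {z : K} (hzg : z ≠ g)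
    (hz : ‖z - g‖ * ‖μ‖ ^ k < r) : EntersPuncturedDisk P Q g r z := by
  set f := ratEval P Q with hf
  -- `(n - 1) * j` is congruent to `-j` modulo `n`: `x` is the backward orbit of `g` inside the
  -- cycle.
  obtain ⟨x, hx⟩ : ∃ x : ℕ → K, x = fun j => f^[(n - 1) * j] g := ⟨_, rfl⟩
  have hgper : ∀ m, f^[n * m] g = g := fun m => by
    rw [Function.iterate_mul]
    exact Function.iterate_fixed hper m
  have hfx : ∀ j, f (x (j + 1)) = x j := by
    intro j
    rw [hx]
    simp only
    rw [← Function.iterate_succ_apply' f]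
    have : (n - 1) * (j + 1) + 1 = (n - 1) * j + n * 1 := by
      rw [Nat.mul_succ]; omega
    rw [Nat.succ_eq_add_one, this, Function.iterate_add_apply, hgper]
  have key : ∀ j, ∃ D, HasDerivAt f^[j] D (x j) ∧ D ≠ 0 ∧
      ∀ z, z ≠ x j → ‖z - x j‖ * ‖D‖ < r → EntersPuncturedDisk P Q g r z := by
    intro j
    induction j with
    | zero =>
      refine ⟨1, hasDerivAt_id _, one_ne_zero, fun z hz hz' => ?_⟩
      have h0 : x 0 = g := by simp [hx]
      rw [h0] at hz hz'
      exact ⟨0, by simp, norm_pos_iff.2 (sub_ne_zero.2 hz), by simpa using hz'⟩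
    | succ j ih =>
      obtain ⟨D, hD, hD0, hDz⟩ := ih
      have hQx : Q.eval (x (j + 1)) ≠ 0 := by rw [hx]; exact hpole _
      have hTx : (derivNum P Q).eval (x (j + 1)) ≠ 0 := by rw [hx]; exact hcycle _
      have hD' : 0 < ‖D‖ := norm_pos_iff.2 hD0
      obtain ⟨y, hy⟩ : ∃ y, y = x j := ⟨_, rfl⟩
      -- Translating the target by `y` centres the disk at `0` and leaves `derivNum` and the degree
      -- unchanged.
      obtain ⟨P', hP'⟩ : ∃ P', P' = P - C y * Q := ⟨_, rfl⟩
      have hPe : ∀ z, P'.eval z = P.eval z - y * Q.eval z := fun z => by simp [hP']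
      have hT : derivNum P' Q = derivNum P Q := by
        simp only [hP', derivNum, derivative_sub, derivative_mul, derivative_C]; ring
      have hd : P'.natDegree = P.natDegree := by
        rw [hP']
        exact natDegree_sub_eq_left_of_natDegree_lt ((natDegree_C_mul_le _ _).trans_lt hdeg)
      have hquot : ∀ z, Q.eval z ≠ 0 → P'.eval z / Q.eval z = f z - y := fun z hz => by
        rw [hPe, hf, ratEval]; field_simp
      have hx0 : P'.eval (x (j + 1)) = 0 := by
        have := hquot _ hQx
        rw [hfx, hy, sub_self, div_eq_zero_iff] at this
        exact this.resolve_right hQx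
      refine ⟨D * ((derivNum P Q).eval (x (j + 1)) / Q.eval (x (j + 1)) ^ 2), ?_,
        mul_ne_zero hD0 (div_ne_zero hTx (pow_ne_zero 2 hQx)), fun z hz hz' => ?_⟩
      · rw [Function.iterate_succ]
        refine HasDerivAt.comp _ ?_ (hasDerivAt_ratEval hQx)
        rw [hfx]
        exact hD
      · have hres := norm_div_lt_of_no_critical_value (P := P') (Q := Q) (r := r / ‖D‖)
          (x := x (j + 1)) (z := z) (by rwa [hd]) (by rwa [hd])
          (fun w hw hQw => hcop w (by rw [hPe, hQw, mul_zero, sub_zero] at hw; exact hw) hQw)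
          hx0 (by rwa [hT]) (div_pos hr hD')
          -- A critical value in the punctured disk around `y` would enter the one around `g`. A
          -- critical point mapped to `y` itself is not excluded: it lands on the cycle.
          (fun c hc hTc hlt => by
            rw [hT] at hTc
            by_contra hPc
            have hne : f c ≠ y := by
              intro h
              have := hquot c hc
              rw [h, sub_self, div_eq_zero_iff] at this
              exact this.elim hPc hc
            refine hcrit c hc hTc (hDz _ (hy ▸ hne) ?_)
            rw [hquot c hc, lt_div_iff₀ hD', hy] at hlt
            exact hlt) hz
          (by
            rw [hT, lt_div_iff₀ hD']
            rw [norm_mul] at hz'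
            linarith)
        obtain ⟨h1, h2, h3⟩ := hres
        rw [hquot z h1, lt_div_iff₀ hD', hy] at h3
        refine EntersPuncturedDisk.of_apply h1 (hDz _ ?_ h3)
        intro h
        have := hquot z h1
        rw [← hf] at h
        rw [h, hy, sub_self, div_eq_zero_iff] at this
        exact this.elim h2 h1
  obtain ⟨D, hD, -, hDz⟩ := key (n * k)
  have hxg : x (n * k) = g := by
    rw [hx]
    simp only
    rw [Nat.mul_comm (n - 1), Nat.mul_assoc]
    exact hgper _
  rw [hxg] at hD hDz
  have hDμ : D = μ ^ k := by
    rw [Function.iterate_mul] at hD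
    exact hD.unique (HasDerivAt.iterate _ hμ hper k)
  refine hDz z hzg ?_
  rwa [hDμ, norm_pow]

/-- The main theorem for a rational function `P / Q` fixing `∞`. -/
theorem exists_critical_point_strictly_attracted (hdeg : Q.natDegree < P.natDegree)
    (hd : 2 ≤ P.natDegree) (htame : ∀ k : ℕ, 1 ≤ k → k ≤ P.natDegree → ‖(k : K)‖ = 1)
    (hcop : ∀ z, P.eval z = 0 → Q.eval z ≠ 0) {g μ : K} {n : ℕ} (hn : 1 ≤ n)
    (hper : (ratEval P Q)^[n] g = g) (hpole : ∀ j, Q.eval ((ratEval P Q)^[j] g) ≠ 0)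
    (hμ : HasDerivAt (ratEval P Q)^[n] μ g) (hμ0 : 0 < ‖μ‖) (hμ1 : ‖μ‖ < 1) :
    ∃ c, (derivNum P Q).eval c = 0 ∧ (∀ l, Q.eval ((ratEval P Q)^[l] c) ≠ 0) ∧
      (∀ l, (ratEval P Q)^[l] c ≠ g) ∧
      ∃ k < n, Tendsto (fun m => (ratEval P Q)^[n * m] c) atTop
        (𝓝 ((ratEval P Q)^[k] g)) := by
  classical
  have hμne : μ ≠ 0 := norm_pos_iff.1 hμ0
  -- By the chain rule a critical point on the cycle would make the multiplier vanish. The iterate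
  -- `n * (j + 1)` is used because it is long enough to pass the `j`-th point.
  have hcycle : ∀ j, (derivNum P Q).eval ((ratEval P Q)^[j] g) ≠ 0 := by
    intro j h0
    have hj : n * (j + 1) = (n * (j + 1) - (j + 1)) + 1 + j := by
      have : j + 1 ≤ n * (j + 1) := Nat.le_mul_of_pos_left _ hn
      omega
    have h1 : HasDerivAt (ratEval P Q)^[n * (j + 1)] (μ ^ (j + 1)) g := by
      rw [Function.iterate_mul]; exact HasDerivAt.iterate _ hμ hper (j + 1)
    obtain ⟨e, he⟩ : ∃ e, e = n * (j + 1) - (j + 1) := ⟨_, rfl⟩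
    rw [← he] at hj
    have hpole' : ∀ l m, Q.eval ((ratEval P Q)^[l] ((ratEval P Q)^[m] g)) ≠ 0 := fun l m => by
      rw [← Function.iterate_add_apply]; exact hpole _
    have h2 := hasDerivAt_ratEval (P := P) (hpole j)
    rw [h0, zero_div] at h2
    have h3 := h2.comp g (differentiableAt_iterate_ratEval j fun i _ => hpole i).hasDerivAt
    have h4 := (differentiableAt_iterate_ratEval (P := P) (Q := Q)
      (g := ratEval P Q ((ratEval P Q)^[j] g)) e (fun l _ => by
      rw [← Function.iterate_succ_apply' (ratEval P Q)]; exact hpole' l _)).hasDerivAt.comp g h3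
    rw [zero_mul, mul_zero] at h4
    have e1 : (ratEval P Q)^[n * (j + 1)]
        = (ratEval P Q)^[e] ∘ (ratEval P Q ∘ (ratEval P Q)^[j]) := by
      rw [hj, Nat.add_assoc, Function.iterate_add, Nat.add_comm 1 j, Function.iterate_succ']
    rw [← e1] at h4
    exact pow_ne_zero _ hμne (h1.unique h4)
  obtain ⟨r, hr, hr'⟩ := exists_contracting_disk hper hpole hμ hμ0
  by_contra hcon
  have hcrit : ∀ c, Q.eval c ≠ 0 → (derivNum P Q).eval c = 0 →
      ¬ EntersPuncturedDisk P Q g r (ratEval P Q c) := by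
    intro c hc hTc h
    obtain ⟨h1, h2, h3⟩ := (h.of_apply hc).strictly_attracted hn hper hpole hμ0 hμ1 hr'
    exact hcon ⟨c, hTc, h1, h2, h3⟩
  obtain ⟨P', hP'⟩ : ∃ P', P' = P - C (ratEval P Q g) * Q := ⟨_, rfl⟩
  have hQg : Q.eval g ≠ 0 := hpole 0
  have hP'd : P'.natDegree = P.natDegree := by
    rw [hP']
    exact natDegree_sub_eq_left_of_natDegree_lt ((natDegree_C_mul_le _ _).trans_lt hdeg)
  have hP'0 : P' ≠ 0 := by rintro h; rw [h, natDegree_zero] at hP'd; omega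
  have hP'g : P'.IsRoot g := by
    simp only [hP', IsRoot, eval_sub, eval_mul, eval_C, ratEval]
    field_simp; ring
  -- Otherwise `g` would be a root of `P'` of multiplicity at least two, hence critical.
  obtain ⟨x', hx'g, hx'⟩ : ∃ x', x' ≠ g ∧ P'.IsRoot x' := by
    by_contra h
    push Not at h
    have hall : ∀ a ∈ P'.roots, a = g := fun a ha => by
      by_contra hag; exact h a hag (isRoot_of_mem_roots ha)
    have hcard := (IsAlgClosed.splits P').natDegree_eq_card_roots
    have h2 : 1 < P'.rootMultiplicity g := by
      rw [← count_roots, Multiset.eq_replicate_of_mem hall, Multiset.count_replicate_self]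
      omega
    have h3 := ((one_lt_rootMultiplicity_iff_isRoot hP'0).1 h2).2
    refine hcycle 0 ?_
    have hT : derivNum P' Q = derivNum P Q := by
      simp only [hP', derivNum, derivative_sub, derivative_mul, derivative_C]; ring
    rw [Function.iterate_zero, id, ← hT, derivNum, eval_sub, eval_mul, eval_mul,
      show (derivative P').eval g = 0 from h3, show P'.eval g = 0 from hP'g]
    ring
  have hQx' : Q.eval x' ≠ 0 := by
    intro h
    have : P.eval x' = 0 := by
      have := hx'
      simp only [hP', IsRoot, eval_sub, eval_mul, eval_C, h, mul_zero, sub_zero] at this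
      exact this
    exact hcop x' this h
  have hfx' : ratEval P Q x' = ratEval P Q g := by
    have := hx'
    simp only [hP', IsRoot, eval_sub, eval_mul, eval_C] at this
    rw [ratEval, div_eq_iff hQx']
    linear_combination this
  have hlim : Tendsto (fun k => ‖x' - g‖ * ‖μ‖ ^ k) atTop (𝓝 0) := by
    simpa using (tendsto_pow_atTop_nhds_zero_of_lt_one (norm_nonneg μ) hμ1).const_mul ‖x' - g‖
  obtain ⟨k, hk⟩ := (hlim.eventually (gt_mem_nhds hr)).exists
  have hent := entersPuncturedDisk_of_norm_lt hdeg htame hcop hn hper hpole hcycle hμ hr hcrit k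
    hx'g hk
  -- Being strictly attracted, `x'` never reaches `g`; but `f(x') = f(g)` brings it there after `n`
  -- steps.
  refine (hent.strictly_attracted hn hper hpole hμ0 hμ1 hr').2.1 n ?_
  obtain ⟨n', rfl⟩ := Nat.exists_eq_add_of_le hn
  rw [Nat.add_comm, Function.iterate_succ_apply] at hper ⊢
  rw [hfx', hper]

end Affine

/-! ### Homogenized polynomials and their composition. -/

section Homogeneous

/-- The homogenization of `p` in degree `N`, evaluated at `(u, v)`. -/
noncomputable def homEval {K R : Type*} [Field K] [CommRing R] [Algebra K R] (N : ℕ) (p : K[X])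
    (u v : R) : R :=
  ∑ i ∈ Finset.range (N + 1), algebraMap K R (p.coeff i) * u ^ i * v ^ (N - i)

variable {K : Type*} [Field K]

theorem homEval_map {R S : Type*} [CommRing R] [Algebra K R] [CommRing S] [Algebra K S]
    (F : R →ₐ[K] S) (N : ℕ) (p : K[X]) (u v : R) :
    F (homEval N p u v) = homEval N p (F u) (F v) := by
  simp [homEval, map_sum]

theorem homEval_smul {R : Type*} [CommRing R] [Algebra K R] (N : ℕ) (p : K[X]) (t u v : R) :
    homEval N p (t * u) (t * v) = t ^ N * homEval N p u v := by
  rw [homEval, homEval, Finset.mul_sum]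
  refine Finset.sum_congr rfl fun i hi => ?_
  have : t ^ N = t ^ i * t ^ (N - i) := by
    rw [← pow_add]; congr 1; have := Finset.mem_range.1 hi; omega
  rw [mul_pow, mul_pow, this]; ring

theorem homEval_zero_right {R : Type*} [CommRing R] [Algebra K R] (N : ℕ) (p : K[X]) (u : R) :
    homEval N p u 0 = algebraMap K R (p.coeff N) * u ^ N := by
  rw [homEval, Finset.sum_range_succ, Finset.sum_eq_zero, Nat.sub_self]
  · simp
  · intro i hi
    rw [zero_pow (by have := Finset.mem_range.1 hi; omega), mul_zero]

theorem homEval_eq_aeval {L : Type*} [Field L] [Algebra K L] {N : ℕ} {p : K[X]}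
    (hp : p.natDegree ≤ N) (u : L) {v : L} (hv : v ≠ 0) :
    homEval N p u v = v ^ N * aeval (u / v) p := by
  rw [homEval, aeval_eq_sum_range' (Nat.lt_succ_of_le hp), Finset.mul_sum]
  refine Finset.sum_congr rfl fun i hi => ?_
  have : v ^ N = v ^ i * v ^ (N - i) := by
    rw [← pow_add]; congr 1; have := Finset.mem_range.1 hi; omega
  rw [this, Algebra.smul_def, div_pow]
  field_simp

theorem eval_homEval (N : ℕ) (p r s : K[X]) (z : K) :
    (homEval N p r s).eval z = homEval N p (r.eval z) (s.eval z) := by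
  have := homEval_map (aeval z : K[X] →ₐ[K] K) N p r s
  simpa [coe_aeval_eq_eval] using this

theorem natDegree_homEval_le {M N : ℕ} {p r s : K[X]} (hr : r.natDegree ≤ M)
    (hs : s.natDegree ≤ M) : (homEval N p r s).natDegree ≤ N * M := by
  refine natDegree_sum_le_of_forall_le _ _ fun i hi => ?_
  have hi' := Finset.mem_range.1 hi
  have h1 : (algebraMap K K[X] (p.coeff i) * r ^ i).natDegree ≤ i * M := by
    rw [Polynomial.algebraMap_eq]
    exact (natDegree_C_mul_le _ _).trans (natDegree_pow_le_of_le i hr)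
  refine (natDegree_mul_le_of_le h1 (natDegree_pow_le_of_le (N - i) hs)).trans ?_
  rw [← Nat.add_mul, Nat.add_sub_cancel' (by omega)]

/-- Taking the coefficient of formal top degree is evaluation at `∞`; this supplies the case `v = 0`
of `homEval_homEval`. -/
theorem coeff_homEval {M N : ℕ} {p r s : K[X]} (hr : r.natDegree ≤ M) (hs : s.natDegree ≤ M) :
    (homEval N p r s).coeff (N * M) = homEval N p (r.coeff M) (s.coeff M) := by
  rw [homEval, homEval, finsetSum_coeff]
  refine Finset.sum_congr rfl fun i hi => ?_
  have hi' := Finset.mem_range.1 hi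
  have e : N * M = i * M + (N - i) * M := by
    rw [← Nat.add_mul, Nat.add_sub_cancel' (by omega)]
  have h1 : (algebraMap K K[X] (p.coeff i) * r ^ i).natDegree ≤ i * M := by
    rw [Polynomial.algebraMap_eq]
    exact (natDegree_C_mul_le _ _).trans (natDegree_pow_le_of_le i hr)
  rw [e, coeff_mul_add_eq_of_natDegree_le h1 (natDegree_pow_le_of_le (N - i) hs),
    coeff_pow_of_natDegree_le hs, Polynomial.algebraMap_eq, coeff_C_mul,
    coeff_pow_of_natDegree_le hr]
  rfl

theorem homEval_homEval {M N : ℕ} {p r s : K[X]} (hr : r.natDegree ≤ M) (hs : s.natDegree ≤ M)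
    (u v : K) :
    homEval (N * M) (homEval N p r s) u v = homEval N p (homEval M r u v) (homEval M s u v) := by
  by_cases hv : v = 0
  · rw [hv, homEval_zero_right, homEval_zero_right, homEval_zero_right, coeff_homEval hr hs,
      Algebra.algebraMap_self, RingHom.id_apply, RingHom.id_apply, RingHom.id_apply,
      mul_comm _ (u ^ M), mul_comm _ (u ^ M), homEval_smul, ← pow_mul, mul_comm N M, mul_comm]
  · rw [homEval_eq_aeval (natDegree_homEval_le hr hs) u hv, homEval_eq_aeval hr u hv,
      homEval_eq_aeval hs u hv, homEval_smul, coe_aeval_eq_eval, eval_homEval, ← pow_mul,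
      mul_comm N M]

end Homogeneous

/-! ### Rational functions as maps of `P¹(K)`; iteration. -/

section ProjectiveLine

variable {K : Type*} [Field K]

open Classical in
/-- The point of `P¹(K)` with homogeneous coordinates `[u : v]`. -/
noncomputable def proj (u v : K) : OnePoint K :=
  if v = 0 then OnePoint.infty else ((u / v : K) : OnePoint K)

theorem proj_zero (u : K) : proj u 0 = OnePoint.infty := if_pos rfl

theorem proj_of_ne {u v : K} (hv : v ≠ 0) : proj u v = ((u / v : K) : OnePoint K) := if_neg hv

theorem proj_one (u : K) : proj u 1 = (u : OnePoint K) := by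
  rw [proj_of_ne one_ne_zero, div_one]

theorem proj_ne_infty {u v : K} : proj u v ≠ OnePoint.infty ↔ v ≠ 0 := by
  by_cases h : v = 0
  · simp [h, proj_zero]
  · simp [h, proj_of_ne h]

theorem localCoord_proj (u v : K) : localCoord (proj u v) = u / v := by
  by_cases h : v = 0
  · rw [h, proj_zero, div_zero]; rfl
  · rw [proj_of_ne h]; rfl

theorem exists_proj_eq (x : OnePoint K) : ∃ u v, (u ≠ 0 ∨ v ≠ 0) ∧ x = proj u v := by
  induction x with
  | infty => exact ⟨1, 0, Or.inl one_ne_zero, (proj_zero 1).symm⟩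
  | coe a => exact ⟨a, 1, Or.inr one_ne_zero, (proj_one a).symm⟩

theorem proj_eq_proj_iff {u v u' v' : K} (h : u ≠ 0 ∨ v ≠ 0) (h' : u' ≠ 0 ∨ v' ≠ 0) :
    proj u v = proj u' v' ↔ u * v' = u' * v := by
  by_cases hv : v = 0
  · have hu := h.resolve_right (not_not.2 hv)
    by_cases hv' : v' = 0
    · simp [hv, hv', proj_zero]
    · rw [hv, proj_zero, proj_of_ne hv']
      simp [hu, hv']
  · by_cases hv' : v' = 0
    · have hu' := h'.resolve_right (not_not.2 hv')
      rw [hv', proj_zero, proj_of_ne hv]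
      simp [hu', hv]
    · rw [proj_of_ne hv, proj_of_ne hv', OnePoint.coe_eq_coe, div_eq_div_iff hv hv']

theorem proj_mul_left {t u v : K} (ht : t ≠ 0) : proj (t * u) (t * v) = proj u v := by
  by_cases hv : v = 0
  · rw [hv, mul_zero, proj_zero, proj_zero]
  · rw [proj_of_ne hv, proj_of_ne (mul_ne_zero ht hv), mul_div_mul_left _ _ ht]

/-- The rational function `φ` is `P / Q`, where the homogenizations of `P` and `Q` in degree `N`
have no common zero. -/
structure IsRep (φ : RatFunc K) (P Q : K[X]) (N : ℕ) : Prop where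
  eq : algebraMap K[X] (RatFunc K) Q * φ = algebraMap K[X] (RatFunc K) P
  natDegree_left : P.natDegree ≤ N
  natDegree_right : Q.natDegree ≤ N
  ne_zero : ∀ u v : K, (u ≠ 0 ∨ v ≠ 0) → homEval N P u v ≠ 0 ∨ homEval N Q u v ≠ 0

theorem eval_eq_homEval {N : ℕ} {P : K[X]} (hP : P.natDegree ≤ N) (a : K) :
    homEval N P a 1 = P.eval a := by
  rw [homEval_eq_aeval hP a one_ne_zero, div_one, one_pow, one_mul, coe_aeval_eq_eval]

theorem natDegree_num_le (φ : RatFunc K) : φ.num.natDegree ≤ degree φ := le_max_left _ _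

theorem natDegree_denom_le (φ : RatFunc K) : φ.denom.natDegree ≤ degree φ := le_max_right _ _

theorem isRep_self (φ : RatFunc K) : IsRep φ φ.num φ.denom (degree φ) where
  eq := by
    rw [mul_comm, ← eq_div_iff (RatFunc.algebraMap_ne_zero φ.denom_ne_zero), RatFunc.num_div_denom]
  natDegree_left := le_max_left _ _
  natDegree_right := le_max_right _ _
  ne_zero := by
    intro u v huv
    by_cases hv : v = 0
    · have hu := huv.resolve_right (not_not.2 hv)
      rw [hv, homEval_zero_right, homEval_zero_right]
      rcases max_cases φ.num.natDegree φ.denom.natDegree with ⟨h, _⟩ | ⟨h, h'⟩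
      · by_cases h0 : φ.num = 0
        · right
          refine mul_ne_zero ?_ (pow_ne_zero _ hu)
          have : φ = 0 := RatFunc.num_eq_zero_iff.1 h0
          simp [degree, this]
        · left
          refine mul_ne_zero ?_ (pow_ne_zero _ hu)
          rw [degree, h]
          exact leadingCoeff_ne_zero.2 h0
      · right
        refine mul_ne_zero ?_ (pow_ne_zero _ hu)
        rw [degree, h]
        exact leadingCoeff_ne_zero.2 φ.denom_ne_zero
    · rw [homEval_eq_aeval (natDegree_num_le φ) u hv, homEval_eq_aeval (natDegree_denom_le φ) u hv]
      by_contra h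
      push Not at h
      obtain ⟨h1, h2⟩ := h
      obtain ⟨A, B, hAB⟩ := RatFunc.isCoprime_num_denom φ
      have h3 := (mul_eq_zero.1 h1).resolve_left (pow_ne_zero _ hv)
      have h4 := (mul_eq_zero.1 h2).resolve_left (pow_ne_zero _ hv)
      have := congrArg (aeval (u / v)) hAB
      rw [map_add, map_mul, map_mul, h3, h4, mul_zero, mul_zero, add_zero, map_one] at this
      exact zero_ne_one this

theorem toMap_eq_proj_self (φ : RatFunc K) {u v : K} (huv : u ≠ 0 ∨ v ≠ 0) :
    toMap φ (proj u v)
      = proj (homEval (degree φ) φ.num u v) (homEval (degree φ) φ.denom u v) := by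
  by_cases hv : v = 0
  · have hu := huv.resolve_right (not_not.2 hv)
    rw [hv, proj_zero, homEval_zero_right, homEval_zero_right, mul_comm _ (u ^ _),
      mul_comm _ (u ^ _), proj_mul_left (pow_ne_zero _ hu)]
    rfl
  · rw [homEval_eq_aeval (natDegree_num_le φ) u hv, homEval_eq_aeval (natDegree_denom_le φ) u hv,
      proj_mul_left (pow_ne_zero _ hv), proj_of_ne hv]
    rfl

/-- Cross-multiplication gives `num * Q = P * denom`, read off at `∞` from the coefficient of degree
`degree φ + N`. Thus composites can be evaluated without reducing them to lowest terms. -/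
theorem IsRep.toMap_proj {φ : RatFunc K} {P Q : K[X]} {N : ℕ} (h : IsRep φ P Q N) {u v : K}
    (huv : u ≠ 0 ∨ v ≠ 0) :
    toMap φ (proj u v) = proj (homEval N P u v) (homEval N Q u v) := by
  rw [toMap_eq_proj_self φ huv, proj_eq_proj_iff ((isRep_self φ).ne_zero u v huv)
    (h.ne_zero u v huv)]
  have hmul : φ.num * Q = P * φ.denom := by
    apply RatFunc.algebraMap_injective K
    rw [map_mul, map_mul, ← h.eq, ← (isRep_self φ).eq]
    ring
  by_cases hv : v = 0
  · have hc := congrArg (fun F => F.coeff (degree φ + N)) hmul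
    rw [coeff_mul_add_eq_of_natDegree_le (isRep_self φ).natDegree_left h.natDegree_right,
      add_comm, coeff_mul_add_eq_of_natDegree_le h.natDegree_left
        (isRep_self φ).natDegree_right] at hc
    simp only [hv, homEval_zero_right, Algebra.algebraMap_self, RingHom.id_apply]
    linear_combination u ^ degree φ * u ^ N * hc
  · have hc := congrArg (aeval (u / v)) hmul
    rw [map_mul, map_mul] at hc
    rw [homEval_eq_aeval h.natDegree_left u hv, homEval_eq_aeval h.natDegree_right u hv,
      homEval_eq_aeval (natDegree_num_le φ) u hv, homEval_eq_aeval (natDegree_denom_le φ) u hv]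
    linear_combination v ^ degree φ * v ^ N * hc

theorem IsRep.denom_ne_zero {φ : RatFunc K} {P Q : K[X]} {N : ℕ} (h : IsRep φ P Q N) :
    Q ≠ 0 := by
  rintro rfl
  have h1 := h.eq
  rw [map_zero, zero_mul] at h1
  have h2 : P = 0 := by
    apply RatFunc.algebraMap_injective K
    rw [← h1, map_zero]
  have := h.ne_zero 1 0 (Or.inl one_ne_zero)
  simp [h2, homEval] at this

/-- Substitution of a nonconstant rational function, on the level of numerators and
denominators. -/
theorem IsRep.comp {φ ψ : RatFunc K} {R S : K[X]} {M : ℕ}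
    (hψ : IsRep ψ R S M) (hc : ¬ ∃ c, ψ = RatFunc.C c) :
    IsRep (comp φ ψ) (homEval (degree φ) φ.num R S) (homEval (degree φ) φ.denom R S)
      (degree φ * M) where
  eq := by
    have hS : algebraMap K[X] (RatFunc K) S ≠ 0 := RatFunc.algebraMap_ne_zero hψ.denom_ne_zero
    have hψ' : algebraMap K[X] (RatFunc K) R / algebraMap K[X] (RatFunc K) S = ψ := by
      rw [div_eq_iff hS, ← hψ.eq, mul_comm]
    have hmap : ∀ p : K[X], p.natDegree ≤ degree φ →
        algebraMap K[X] (RatFunc K) (homEval (degree φ) p R S)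
          = algebraMap K[X] (RatFunc K) S ^ degree φ * aeval ψ p := by
      intro p hp
      have := homEval_map (IsScalarTower.toAlgHom K K[X] (RatFunc K)) (degree φ) p R S
      rw [IsScalarTower.coe_toAlgHom'] at this
      rw [this, homEval_eq_aeval hp _ hS, hψ']
    have hne : aeval ψ φ.denom ≠ 0 := fun h0 =>
      φ.denom_ne_zero ((transcendental_iff.1 (RatFunc.transcendental_of_ne_C ψ hc)) _ h0)
    have hcomp : RationalDynamics.comp φ ψ = aeval ψ φ.num / aeval ψ φ.denom := rfl
    rw [hmap _ (le_max_left _ _), hmap _ (le_max_right _ _), hcomp]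
    field_simp
  natDegree_left := natDegree_homEval_le hψ.natDegree_left hψ.natDegree_right
  natDegree_right := natDegree_homEval_le hψ.natDegree_left hψ.natDegree_right
  ne_zero := fun u v huv => by
    rw [homEval_homEval hψ.natDegree_left hψ.natDegree_right,
      homEval_homEval hψ.natDegree_left hψ.natDegree_right]
    exact (isRep_self φ).ne_zero _ _ (hψ.ne_zero u v huv)

theorem toMap_comp (φ : RatFunc K) {ψ : RatFunc K} (hc : ¬ ∃ c, ψ = RatFunc.C c)
    (x : OnePoint K) : toMap (comp φ ψ) x = toMap φ (toMap ψ x) := by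
  obtain ⟨u, v, huv, rfl⟩ := exists_proj_eq x
  have h := isRep_self ψ
  rw [(h.comp (φ := φ) hc).toMap_proj huv, h.toMap_proj huv,
    (isRep_self φ).toMap_proj (h.ne_zero u v huv),
    homEval_homEval h.natDegree_left h.natDegree_right,
    homEval_homEval h.natDegree_left h.natDegree_right]

theorem not_const_of_degree_pos {φ : RatFunc K} (h : 0 < degree φ) : ¬ ∃ c, φ = RatFunc.C c := by
  rintro ⟨c, rfl⟩
  simp [degree] at h

/-- A nonconstant `ψ` is transcendental over `K`, so `num - c * denom` vanishes at `ψ` only if it is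
zero. -/
theorem comp_not_const {φ ψ : RatFunc K} (hφ : ¬ ∃ c, φ = RatFunc.C c)
    (hψ : ¬ ∃ c, ψ = RatFunc.C c) : ¬ ∃ c, comp φ ψ = RatFunc.C c := by
  rintro ⟨c, hc⟩
  have htr := transcendental_iff.1 (RatFunc.transcendental_of_ne_C ψ hψ)
  have hne : aeval ψ φ.denom ≠ 0 := fun h0 => φ.denom_ne_zero (htr _ h0)
  have hcomp : comp φ ψ = aeval ψ φ.num / aeval ψ φ.denom := rfl
  rw [hcomp, div_eq_iff hne] at hc
  have h0 : aeval ψ (φ.num - C c * φ.denom) = 0 := by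
    rw [map_sub, map_mul, aeval_C, hc, sub_eq_zero]; rfl
  have h1 := sub_eq_zero.1 (htr _ h0)
  refine hφ ⟨c, ?_⟩
  rw [← RatFunc.num_div_denom φ, div_eq_iff (RatFunc.algebraMap_ne_zero φ.denom_ne_zero), h1,
    map_mul, RatFunc.algebraMap_C]

theorem X_not_const : ¬ ∃ c : K, (RatFunc.X : RatFunc K) = RatFunc.C c := by
  apply not_const_of_degree_pos
  simp [degree]

theorem homEval_one_X (u v : K) : homEval 1 (X : K[X]) u v = u := by
  simp [homEval, Finset.sum_range_succ]

theorem homEval_one_one (u v : K) : homEval 1 (1 : K[X]) u v = v := by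
  simp [homEval, coeff_one]

theorem toMap_X (x : OnePoint K) : toMap RatFunc.X x = x := by
  have h : IsRep (RatFunc.X : RatFunc K) X 1 1 := by
    refine ⟨by simp, natDegree_X_le, by simp, fun u v huv => ?_⟩
    rwa [homEval_one_X, homEval_one_one]
  obtain ⟨u, v, huv, rfl⟩ := exists_proj_eq x
  rw [h.toMap_proj huv, homEval_one_X, homEval_one_one]

theorem iter_not_const {φ : RatFunc K} (hφ : ¬ ∃ c, φ = RatFunc.C c) (n : ℕ) :
    ¬ ∃ c, iter φ n = RatFunc.C c := by
  induction n with
  | zero => exact X_not_const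
  | succ n ih => exact comp_not_const hφ ih

theorem toMap_iter {φ : RatFunc K} (hφ : ¬ ∃ c, φ = RatFunc.C c) (n : ℕ) :
    toMap (iter φ n) = (toMap φ)^[n] := by
  induction n with
  | zero => funext x; exact toMap_X x
  | succ n ih =>
    funext x
    rw [Function.iterate_succ_apply', ← ih]
    exact toMap_comp φ (iter_not_const hφ n) x

end ProjectiveLine

/-! ### Local charts and Möbius parametrizations. -/

section Charts

variable {K : Type*} [Field K]

/-- The inversion `z ↦ 1 / z` of `P¹(K)`. -/
noncomputable def inversion (x : OnePoint K) : OnePoint K := toMap (RatFunc.X)⁻¹ x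

open Classical in
/-- The change of coordinate `z ↦ 1 / z` if `x = ∞`, and the identity otherwise. -/
noncomputable def chart (x z : OnePoint K) : OnePoint K :=
  if x = OnePoint.infty then inversion z else z

theorem inv_X_not_const : ¬ ∃ c : K, (RatFunc.X : RatFunc K)⁻¹ = RatFunc.C c := by
  rintro ⟨c, hc⟩
  refine X_not_const (K := K) ⟨c⁻¹, ?_⟩
  rw [map_inv₀, ← hc, inv_inv]

theorem inversion_proj {u v : K} (huv : u ≠ 0 ∨ v ≠ 0) : inversion (proj u v) = proj v u := by
  have h : IsRep ((RatFunc.X : RatFunc K)⁻¹) 1 X 1 := by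
    refine ⟨by simp [RatFunc.X_ne_zero], by simp, natDegree_X_le, fun u v huv => ?_⟩
    rw [homEval_one_X, homEval_one_one]
    exact huv.symm
  rw [inversion, h.toMap_proj huv, homEval_one_X, homEval_one_one]

theorem inversion_inversion (x : OnePoint K) : inversion (inversion x) = x := by
  obtain ⟨u, v, huv, rfl⟩ := exists_proj_eq x
  rw [inversion_proj huv, inversion_proj huv.symm]

theorem chart_chart (x z : OnePoint K) : chart x (chart x z) = z := by
  unfold chart
  split_ifs
  · exact inversion_inversion z
  · rfl

theorem chart_self (x : OnePoint K) : chart x x = ((localCoord x : K) : OnePoint K) := by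
  induction x with
  | infty =>
    rw [chart, if_pos rfl, ← proj_zero (1 : K), inversion_proj (Or.inl one_ne_zero), proj_one,
      localCoord_proj, div_zero]
  | coe a => rw [chart, if_neg (OnePoint.coe_ne_infty a)]; rfl

theorem chart_localCoord (x : OnePoint K) : chart x ((localCoord x : K) : OnePoint K) = x := by
  rw [← chart_self, chart_chart]

theorem localCoord_coe (a : K) : localCoord (a : OnePoint K) = a := rfl

theorem localCoord_toMap_coe (φ : RatFunc K) (t : K) :
    localCoord (toMap φ (t : OnePoint K)) = ratEval φ.num φ.denom t := by
  rw [← proj_one t, toMap_eq_proj_self φ (Or.inr one_ne_zero), localCoord_proj,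
    eval_eq_homEval (natDegree_num_le φ), eval_eq_homEval (natDegree_denom_le φ)]
  rfl

theorem toMap_coe_ne_infty {φ : RatFunc K} {t : K}
    (h : toMap φ (t : OnePoint K) ≠ OnePoint.infty) : φ.denom.eval t ≠ 0 := by
  rwa [← proj_one t, toMap_eq_proj_self φ (Or.inr one_ne_zero), proj_ne_infty,
    eval_eq_homEval (natDegree_denom_le φ)] at h

theorem toMap_inv {φ : RatFunc K} (hφ : φ ≠ 0) (x : OnePoint K) :
    toMap φ⁻¹ x = inversion (toMap φ x) := by
  have h := isRep_self φ
  have h' : IsRep φ⁻¹ φ.denom φ.num (degree φ) := by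
    refine ⟨?_, h.natDegree_right, h.natDegree_left, fun u v huv => (h.ne_zero u v huv).symm⟩
    rw [← h.eq, mul_assoc, mul_inv_cancel₀ hφ, mul_one]
  obtain ⟨u, v, huv, rfl⟩ := exists_proj_eq x
  rw [h.toMap_proj huv, h'.toMap_proj huv, inversion_proj (h.ne_zero u v huv)]

theorem ne_zero_of_not_const {φ : RatFunc K} (hφ : ¬ ∃ c, φ = RatFunc.C c) : φ ≠ 0 := by
  rintro rfl
  exact hφ ⟨0, (map_zero _).symm⟩

theorem toMap_inCharts {φ : RatFunc K} (hφ : ¬ ∃ c, φ = RatFunc.C c) (x y z : OnePoint K) :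
    toMap (inCharts φ x y) z = chart y (toMap φ (chart x z)) := by
  have hψ : ∀ z, toMap (comp φ (RatFunc.X)⁻¹) z = toMap φ (inversion z) :=
    toMap_comp φ inv_X_not_const
  have hne := ne_zero_of_not_const (comp_not_const hφ (inv_X_not_const (K := K)))
  unfold inCharts chart
  simp only
  split_ifs
  · rw [toMap_inv hne, hψ]
  · rw [toMap_inv (ne_zero_of_not_const hφ)]
  · rw [hψ]
  · rfl

/-- The Möbius map `z ↦ (a z + b) / (c z + d)`, as a parametrization of `P¹(K)` minus a point. -/
noncomputable def mobius (a b c d z : K) : OnePoint K := proj (a * z + b) (c * z + d)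

variable {a b c d : K}

theorem mobius_coord_ne_zero (hdet : a * d - b * c ≠ 0) (z : K) :
    a * z + b ≠ 0 ∨ c * z + d ≠ 0 := by
  by_contra h
  push Not at h
  exact hdet (by linear_combination (-c) * h.1 + a * h.2)

theorem mobius_pole_coord_ne_zero (hdet : a * d - b * c ≠ 0) : a ≠ 0 ∨ c ≠ 0 := by
  by_contra h
  push Not at h
  exact hdet (by rw [h.1, h.2]; ring)

theorem mobius_injective (hdet : a * d - b * c ≠ 0) : Function.Injective (mobius a b c d) := by
  intro z w h
  have := (proj_eq_proj_iff (mobius_coord_ne_zero hdet z) (mobius_coord_ne_zero hdet w)).1 h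
  have h2 : (a * d - b * c) * (z - w) = 0 := by linear_combination this
  exact sub_eq_zero.1 ((mul_eq_zero.1 h2).resolve_left hdet)

theorem mobius_ne (hdet : a * d - b * c ≠ 0) (z : K) : mobius a b c d z ≠ proj a c := by
  intro h
  have := (proj_eq_proj_iff (mobius_coord_ne_zero hdet z) (mobius_pole_coord_ne_zero hdet)).1 h
  exact hdet (by linear_combination -this)

theorem exists_mobius_eq (hdet : a * d - b * c ≠ 0) {x : OnePoint K} (hx : x ≠ proj a c) :
    ∃ z, x = mobius a b c d z := by
  obtain ⟨u, v, huv, rfl⟩ := exists_proj_eq x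
  rw [Ne, proj_eq_proj_iff huv (mobius_pole_coord_ne_zero hdet)] at hx
  have hne : a * v - c * u ≠ 0 := fun h => hx (by linear_combination -h)
  have hz : (d * u - b * v) / (a * v - c * u) * (a * v - c * u) = d * u - b * v :=
    div_mul_cancel₀ _ hne
  refine ⟨(d * u - b * v) / (a * v - c * u), ?_⟩
  rw [mobius, proj_eq_proj_iff huv (mobius_coord_ne_zero hdet _)]
  linear_combination -hz

end Charts

/-! ### Derivatives under change of coordinate. -/

section Derivatives

open Filter Topology

variable {K : Type*} [NontriviallyNormedField K]

/-- Identifies the formal derivative with the analytic one, so that the chain rule applies. -/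
theorem hasDerivAt_localDeriv {φ : RatFunc K} (hφ : ¬ ∃ c, φ = RatFunc.C c) (x : OnePoint K) :
    HasDerivAt
      (fun t : K => localCoord (chart (toMap φ x) (toMap φ (chart x (t : OnePoint K)))))
      (localDeriv φ x (toMap φ x)) (localCoord x) := by
  have e : (fun t : K => localCoord (chart (toMap φ x) (toMap φ (chart x (t : OnePoint K)))))
      = ratEval (inCharts φ x (toMap φ x)).num (inCharts φ x (toMap φ x)).denom := by
    funext t
    rw [← toMap_inCharts hφ, localCoord_toMap_coe]
  rw [e]
  have hne : (inCharts φ x (toMap φ x)).denom.eval (localCoord x) ≠ 0 := by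
    apply toMap_coe_ne_infty
    rw [toMap_inCharts hφ, chart_localCoord, chart_self]
    exact OnePoint.coe_ne_infty _
  have := hasDerivAt_ratEval (P := (inCharts φ x (toMap φ x)).num) hne
  rwa [derivNum, eval_sub, eval_mul, eval_mul] at this

/-- The eventual equality records that the chart value is finite near `w`: `localCoord` sends `∞` to
`0` and alone would not determine the point. -/
theorem exists_hasDerivAt_mobius {a b c d : K} (hdet : a * d - b * c ≠ 0) (w : K) :
    ∃ D ≠ 0, HasDerivAt
        (fun z => localCoord (chart (mobius a b c d w) (mobius a b c d z))) D w ∧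
      ∀ᶠ z in 𝓝 w, chart (mobius a b c d w) (mobius a b c d z)
        = ((localCoord (chart (mobius a b c d w) (mobius a b c d z)) : K) : OnePoint K) := by
  have hlin : ∀ p q : K, HasDerivAt (fun z => p * z + q) p w := fun p q => by
    simpa using ((hasDerivAt_id w).const_mul p).add_const q
  have key : ∀ p q r s : K, p * s - q * r ≠ 0 → r * w + s ≠ 0 →
      ∃ D ≠ 0, HasDerivAt (fun z => localCoord (proj (p * z + q) (r * z + s))) D w ∧
        ∀ᶠ z in 𝓝 w, proj (p * z + q) (r * z + s)
          = ((localCoord (proj (p * z + q) (r * z + s)) : K) : OnePoint K) := by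
    intro p q r s hdet hw
    refine ⟨(p * s - q * r) / (r * w + s) ^ 2, div_ne_zero hdet (pow_ne_zero 2 hw), ?_, ?_⟩
    · simp only [localCoord_proj]
      have := (hlin p q).div (hlin r s) hw
      have e : p * (r * w + s) - (p * w + q) * r = p * s - q * r := by ring
      rw [e] at this
      exact this
    · filter_upwards [(hlin r s).continuousAt.eventually_ne hw] with z hz
      rw [localCoord_proj, proj_of_ne hz]
  by_cases hw : c * w + d = 0
  · have h1 : mobius a b c d w = OnePoint.infty := by rw [mobius, hw, proj_zero]
    have h2 : ∀ z, chart (mobius a b c d w) (mobius a b c d z)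
        = proj (c * z + d) (a * z + b) := fun z => by
      rw [chart, if_pos h1, mobius, inversion_proj (mobius_coord_ne_zero hdet z)]
    simp only [h2]
    exact key c d a b (fun h => hdet (by linear_combination -h))
      ((mobius_coord_ne_zero hdet w).resolve_right (not_not.2 hw))
  · have h1 : mobius a b c d w ≠ OnePoint.infty := proj_ne_infty.2 hw
    have h2 : ∀ z, chart (mobius a b c d w) (mobius a b c d z)
        = proj (a * z + b) (c * z + d) := fun z => by rw [chart, if_neg h1, mobius]
    simp only [h2]
    exact key a b c d hdet hw

/-- The derivatives of a map in the coordinate of a Möbius parametrization, and in the standard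
local coordinates, agree up to a coboundary. -/
theorem exists_localDeriv_mobius {a b c d : K} (hdet : a * d - b * c ≠ 0) :
    ∃ D : K → K, (∀ w, D w ≠ 0) ∧ ∀ (φ : RatFunc K) (_ : ¬ ∃ c, φ = RatFunc.C c) (f : K → K)
      (w μ : K), (∀ᶠ z in 𝓝 w, toMap φ (mobius a b c d z) = mobius a b c d (f z)) →
      HasDerivAt f μ w →
      localDeriv φ (mobius a b c d w) (mobius a b c d (f w)) * D w = D (f w) * μ := by
  choose D hD0 hD hDev using exists_hasDerivAt_mobius hdet
  refine ⟨D, hD0, fun φ hφ f w μ hev hf => ?_⟩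
  have hfw := hev.self_of_nhds
  have h1 := hasDerivAt_localDeriv hφ (mobius a b c d w)
  rw [hfw] at h1
  have hx : localCoord (chart (mobius a b c d w) (mobius a b c d w))
      = localCoord (mobius a b c d w) := by rw [chart_self, localCoord_coe]
  rw [← hx] at h1
  have h2 := h1.comp w (hD w)
  have h3 := (hD (f w)).comp w hf
  refine h2.unique (h3.congr_of_eventuallyEq ?_)
  filter_upwards [hev, hDev w] with z hz hz'
  simp only [Function.comp_apply]
  rw [← hz', chart_chart, hz]

end Derivatives

/-! ### Chordal convergence in a Möbius coordinate. -/

section Chordal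

open Filter Topology

variable {K : Type*} [NormedField K]

theorem chordalDist_proj {u v u' v' : K} (h : u ≠ 0 ∨ v ≠ 0) (h' : u' ≠ 0 ∨ v' ≠ 0) :
    chordalDist (proj u v) (proj u' v')
      = ‖u * v' - u' * v‖ / (max ‖u‖ ‖v‖ * max ‖u'‖ ‖v'‖) := by
  have hmax : ∀ u v : K, v ≠ 0 → max ‖u‖ ‖v‖ = ‖v‖ * max 1 ‖u / v‖ := by
    intro u v hv
    rw [mul_max_of_nonneg _ _ (norm_nonneg v), mul_one, norm_div,
      mul_div_cancel₀ _ (norm_ne_zero_iff.2 hv), max_comm]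
  by_cases hv : v = 0
  · have hu := h.resolve_right (not_not.2 hv)
    have hu0 : ‖u‖ ≠ 0 := norm_ne_zero_iff.2 hu
    by_cases hv' : v' = 0
    · rw [hv, hv', proj_zero, proj_zero]
      simp only [mul_zero, sub_zero, norm_zero, zero_div]
      rfl
    · rw [hv, proj_zero, proj_of_ne hv', hmax u' v' hv']
      have : chordalDist (OnePoint.infty : OnePoint K) ((u' / v' : K) : OnePoint K)
        = 1 / max 1 ‖u' / v'‖ := rfl
      have hv0 : ‖v'‖ ≠ 0 := norm_ne_zero_iff.2 hv'
      rw [this, mul_zero, sub_zero, norm_zero, max_eq_left (norm_nonneg u), norm_mul]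
      field_simp
  · have hv0 : ‖v‖ ≠ 0 := norm_ne_zero_iff.2 hv
    by_cases hv' : v' = 0
    · have hu' := h'.resolve_right (not_not.2 hv')
      have hu0 : ‖u'‖ ≠ 0 := norm_ne_zero_iff.2 hu'
      rw [hv', proj_zero, proj_of_ne hv, hmax u v hv]
      have : chordalDist ((u / v : K) : OnePoint K) (OnePoint.infty : OnePoint K)
        = 1 / max 1 ‖u / v‖ := rfl
      rw [this, mul_zero, zero_sub, norm_neg, norm_zero, max_eq_left (norm_nonneg u'), norm_mul]
      field_simp
    · have hv0' : ‖v'‖ ≠ 0 := norm_ne_zero_iff.2 hv'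
      rw [proj_of_ne hv, proj_of_ne hv', hmax u v hv, hmax u' v' hv']
      have : chordalDist ((u / v : K) : OnePoint K) ((u' / v' : K) : OnePoint K)
        = ‖u / v - u' / v'‖ / (max 1 ‖u / v‖ * max 1 ‖u' / v'‖) := rfl
      rw [this]
      have e : u * v' - u' * v = v * v' * (u / v - u' / v') := by field_simp
      rw [e, norm_mul, norm_mul]
      have h1 : max 1 ‖u / v‖ ≠ 0 := (lt_max_of_lt_left one_pos).ne'
      have h2 : max 1 ‖u' / v'‖ ≠ 0 := (lt_max_of_lt_left one_pos).ne'
      field_simp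

theorem tendsto_chordalDist_mobius {a b c d : K} (hdet : a * d - b * c ≠ 0) {u : ℕ → K} {w : K}
    (h : Tendsto u atTop (𝓝 w)) :
    Tendsto (fun m => chordalDist (mobius a b c d (u m)) (mobius a b c d w)) atTop (𝓝 0) := by
  have e : ∀ z, chordalDist (mobius a b c d z) (mobius a b c d w)
      = ‖(a * z + b) * (c * w + d) - (a * w + b) * (c * z + d)‖ /
        (max ‖a * z + b‖ ‖c * z + d‖ * max ‖a * w + b‖ ‖c * w + d‖) := fun z =>
    chordalDist_proj (mobius_coord_ne_zero hdet z) (mobius_coord_ne_zero hdet w)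
  have hpos : 0 < max ‖a * w + b‖ ‖c * w + d‖ := by
    rcases mobius_coord_ne_zero hdet w with h | h
    · exact lt_max_of_lt_left (norm_pos_iff.2 h)
    · exact lt_max_of_lt_right (norm_pos_iff.2 h)
  have hcont : ContinuousAt (fun z => chordalDist (mobius a b c d z) (mobius a b c d w)) w := by
    simp only [e]
    exact ContinuousAt.div (by fun_prop) (by fun_prop) (mul_pos hpos hpos).ne'
  have h0 : chordalDist (mobius a b c d w) (mobius a b c d w) = 0 := by
    rw [e, sub_self, norm_zero, zero_div]
  have := hcont.tendsto.comp h
  rwa [h0] at this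

end Chordal

/-! ### Moving a fixed point to `∞`. -/

section Conjugation

variable {K : Type*} [Field K]

/-- The numerator of the conjugate of `φ` by the Möbius map `z ↦ (a z + b) / (c z + d)`. -/
noncomputable def conjNum (φ : RatFunc K) (a b c d : K) : K[X] :=
  C d * homEval (degree φ) φ.num (C a * X + C b) (C c * X + C d)
    - C b * homEval (degree φ) φ.denom (C a * X + C b) (C c * X + C d)

/-- The denominator of the conjugate of `φ` by the Möbius map `z ↦ (a z + b) / (c z + d)`. -/
noncomputable def conjDenom (φ : RatFunc K) (a b c d : K) : K[X] :=
  C a * homEval (degree φ) φ.denom (C a * X + C b) (C c * X + C d)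
    - C c * homEval (degree φ) φ.num (C a * X + C b) (C c * X + C d)

variable (φ : RatFunc K) {a b c d : K}

theorem eval_conjNum (z : K) : (conjNum φ a b c d).eval z
    = d * homEval (degree φ) φ.num (a * z + b) (c * z + d)
      - b * homEval (degree φ) φ.denom (a * z + b) (c * z + d) := by
  simp [conjNum, eval_homEval]

theorem eval_conjDenom (z : K) : (conjDenom φ a b c d).eval z
    = a * homEval (degree φ) φ.denom (a * z + b) (c * z + d)
      - c * homEval (degree φ) φ.num (a * z + b) (c * z + d) := by
  simp [conjDenom, eval_homEval]

theorem coeff_homEval_linear (N : ℕ) (p : K[X]) (a b c d : K) :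
    (homEval N p (C a * X + C b) (C c * X + C d)).coeff N = homEval N p a c := by
  have := coeff_homEval (N := N) (p := p) (natDegree_linear_le (a := a) (b := b))
    (natDegree_linear_le (a := c) (b := d))
  rw [mul_one] at this
  rw [this]
  simp

theorem natDegree_homEval_linear_le (N : ℕ) (p : K[X]) (a b c d : K) :
    (homEval N p (C a * X + C b) (C c * X + C d)).natDegree ≤ N := by
  have := natDegree_homEval_le (N := N) (p := p) (natDegree_linear_le (a := a) (b := b))
    (natDegree_linear_le (a := c) (b := d))
  rwa [mul_one] at this

theorem natDegree_conjNum_le : (conjNum φ a b c d).natDegree ≤ degree φ :=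
  (natDegree_sub_le_of_le
    ((natDegree_C_mul_le _ _).trans (natDegree_homEval_linear_le _ _ _ _ _ _))
    ((natDegree_C_mul_le _ _).trans (natDegree_homEval_linear_le _ _ _ _ _ _))).trans
    (max_self _).le

theorem natDegree_conjDenom_le : (conjDenom φ a b c d).natDegree ≤ degree φ :=
  (natDegree_sub_le_of_le
    ((natDegree_C_mul_le _ _).trans (natDegree_homEval_linear_le _ _ _ _ _ _))
    ((natDegree_C_mul_le _ _).trans (natDegree_homEval_linear_le _ _ _ _ _ _))).trans
    (max_self _).le

theorem coeff_conjNum : (conjNum φ a b c d).coeff (degree φ)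
    = d * homEval (degree φ) φ.num a c - b * homEval (degree φ) φ.denom a c := by
  rw [conjNum, coeff_sub, coeff_C_mul, coeff_C_mul, coeff_homEval_linear, coeff_homEval_linear]

theorem coeff_conjDenom : (conjDenom φ a b c d).coeff (degree φ)
    = a * homEval (degree φ) φ.denom a c - c * homEval (degree φ) φ.num a c := by
  rw [conjDenom, coeff_sub, coeff_C_mul, coeff_C_mul, coeff_homEval_linear, coeff_homEval_linear]

variable {φ}

theorem toMap_proj_pole_iff (hdet : a * d - b * c ≠ 0) :
    toMap φ (proj a c) = proj a c ↔ (conjDenom φ a b c d).coeff (degree φ) = 0 := by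
  have hac := mobius_pole_coord_ne_zero hdet
  rw [toMap_eq_proj_self φ hac, proj_eq_proj_iff ((isRep_self φ).ne_zero _ _ hac) hac,
    coeff_conjDenom]
  constructor <;> intro h <;> linear_combination -h

/-- `proj a c` is the image of `∞` under the Möbius map, so the conjugate fixes `∞`. Both top
coefficients cannot vanish, since the matrix is invertible and `φ` is represented without common
zeros. -/
theorem natDegree_conj_of_fixed (hdet : a * d - b * c ≠ 0)
    (h : toMap φ (proj a c) = proj a c) (hφ : 0 < degree φ) :
    (conjNum φ a b c d).natDegree = degree φ ∧ (conjDenom φ a b c d).natDegree < degree φ := by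
  have h0 := (toMap_proj_pole_iff hdet).1 h
  constructor
  · refine le_antisymm (natDegree_conjNum_le φ) (le_natDegree_of_ne_zero fun h1 => ?_)
    rw [coeff_conjNum] at h1
    rw [coeff_conjDenom] at h0
    have h2 : (a * d - b * c) * homEval (degree φ) φ.num a c = 0 := by
      linear_combination a * h1 + b * h0
    have h3 : (a * d - b * c) * homEval (degree φ) φ.denom a c = 0 := by
      linear_combination c * h1 + d * h0
    rcases (isRep_self φ).ne_zero _ _ (mobius_pole_coord_ne_zero hdet) with h | h
    · exact (mul_ne_zero hdet h) h2
    · exact (mul_ne_zero hdet h) h3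
  · refine lt_of_le_of_ne (natDegree_conjDenom_le φ) fun h1 => ?_
    have : conjDenom φ a b c d = 0 := by
      rw [← h1, coeff_natDegree] at h0
      exact leadingCoeff_eq_zero.1 h0
    rw [this, natDegree_zero] at h1
    omega

theorem conj_not_both_zero (hdet : a * d - b * c ≠ 0) (z : K) (h : (conjNum φ a b c d).eval z = 0) :
    (conjDenom φ a b c d).eval z ≠ 0 := by
  intro h'
  rw [eval_conjNum] at h
  rw [eval_conjDenom] at h'
  have h2 : (a * d - b * c) * homEval (degree φ) φ.num (a * z + b) (c * z + d) = 0 := by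
    linear_combination a * h + b * h'
  have h3 : (a * d - b * c) * homEval (degree φ) φ.denom (a * z + b) (c * z + d) = 0 := by
    linear_combination c * h + d * h'
  rcases (isRep_self φ).ne_zero _ _ (mobius_coord_ne_zero hdet z) with h | h
  · exact (mul_ne_zero hdet h) h2
  · exact (mul_ne_zero hdet h) h3

theorem toMap_mobius (hdet : a * d - b * c ≠ 0) {z : K} (hz : (conjDenom φ a b c d).eval z ≠ 0) :
    toMap φ (mobius a b c d z)
      = mobius a b c d (ratEval (conjNum φ a b c d) (conjDenom φ a b c d) z) := by
  have hzc := mobius_coord_ne_zero hdet z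
  rw [mobius, mobius, toMap_eq_proj_self φ hzc, proj_eq_proj_iff
    ((isRep_self φ).ne_zero _ _ hzc) (mobius_coord_ne_zero hdet _)]
  have h : ratEval (conjNum φ a b c d) (conjDenom φ a b c d) z * (conjDenom φ a b c d).eval z
    = (conjNum φ a b c d).eval z := div_mul_cancel₀ _ hz
  rw [eval_conjNum, eval_conjDenom] at h
  linear_combination -h

theorem toMap_mobius_of_pole (hdet : a * d - b * c ≠ 0) {z : K}
    (hz : (conjDenom φ a b c d).eval z = 0) :
    toMap φ (mobius a b c d z) = proj a c := by
  have hzc := mobius_coord_ne_zero hdet z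
  rw [mobius, toMap_eq_proj_self φ hzc, proj_eq_proj_iff
    ((isRep_self φ).ne_zero _ _ hzc) (mobius_pole_coord_ne_zero hdet)]
  rw [eval_conjDenom] at hz
  linear_combination -hz

theorem iterate_toMap_mobius (hdet : a * d - b * c ≠ 0) {z : K} (m : ℕ)
    (hz : ∀ i < m, (conjDenom φ a b c d).eval
      ((ratEval (conjNum φ a b c d) (conjDenom φ a b c d))^[i] z) ≠ 0) :
    (toMap φ)^[m] (mobius a b c d z)
      = mobius a b c d ((ratEval (conjNum φ a b c d) (conjDenom φ a b c d))^[m] z) := by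
  induction m with
  | zero => rfl
  | succ m ih =>
    rw [Function.iterate_succ_apply', Function.iterate_succ_apply',
      ih fun i hi => hz i (Nat.lt_succ_of_lt hi), toMap_mobius hdet (hz m (Nat.lt_succ_self m))]

/-- A periodic orbit avoiding a fixed point stays in the coordinate chart around the other
points. -/
theorem conjDenom_eval_iterate_ne_zero (hdet : a * d - b * c ≠ 0)
    (hfix : toMap φ (proj a c) = proj a c) {g : K} {n : ℕ} (hn : 1 ≤ n)
    (hper : (toMap φ)^[n] (mobius a b c d g) = mobius a b c d g) (j : ℕ) :
    (conjDenom φ a b c d).eval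
      ((ratEval (conjNum φ a b c d) (conjDenom φ a b c d))^[j] g) ≠ 0 := by
  induction j using Nat.strong_induction_on with
  | _ j ih =>
    intro h0
    have h1 := toMap_mobius_of_pole hdet h0
    rw [← iterate_toMap_mobius hdet j ih, ← Function.iterate_succ_apply' (toMap φ)] at h1
    -- After reaching the fixed point the orbit stays there, yet at time `n * (j + 1)` it must be
    -- back at its start.
    obtain ⟨e, he⟩ : ∃ e, n * (j + 1) = e + (j + 1) := by
      have : j + 1 ≤ n * (j + 1) := Nat.le_mul_of_pos_left _ hn
      exact ⟨n * (j + 1) - (j + 1), by omega⟩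
    have h2 : (toMap φ)^[n * (j + 1)] (mobius a b c d g) = mobius a b c d g := by
      rw [Function.iterate_mul]
      exact Function.iterate_fixed hper _
    rw [he, Function.iterate_add_apply, h1, Function.iterate_fixed hfix] at h2
    exact mobius_ne hdet g h2.symm

end Conjugation

/-! ### Invariance of multipliers, fixed points, and tameness. -/

section Multiplier

open Filter Topology

variable {K : Type*} [NontriviallyNormedField K] {φ : RatFunc K} {a b c d : K}

/-- At a fixed point of the iterate the two coboundary factors coincide and cancel. -/
theorem multiplier_eq (hφ : ¬ ∃ c, φ = RatFunc.C c) (hdet : a * d - b * c ≠ 0) {g μ : K} {n : ℕ}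
    (hpole : ∀ i < n, (conjDenom φ a b c d).eval
      ((ratEval (conjNum φ a b c d) (conjDenom φ a b c d))^[i] g) ≠ 0)
    (hper : (ratEval (conjNum φ a b c d) (conjDenom φ a b c d))^[n] g = g)
    (hμ : HasDerivAt (ratEval (conjNum φ a b c d) (conjDenom φ a b c d))^[n] μ g) :
    multiplier φ n (mobius a b c d g) = μ := by
  obtain ⟨D, hD, h⟩ := exists_localDeriv_mobius hdet
  have := h (iter φ n) (iter_not_const hφ n) _ g μ (by
    rw [toMap_iter hφ]
    filter_upwards [eventually_iterate_ratEval_ne hpole] with z hz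
    exact iterate_toMap_mobius hdet n hz) hμ
  rw [hper, mul_comm] at this
  exact mul_left_cancel₀ (hD g) this

theorem isCriticalPoint_mobius (hφ : ¬ ∃ c, φ = RatFunc.C c) (hdet : a * d - b * c ≠ 0) {z : K}
    (hz : (conjDenom φ a b c d).eval z ≠ 0)
    (h0 : (derivNum (conjNum φ a b c d) (conjDenom φ a b c d)).eval z = 0) :
    IsCriticalPoint φ (mobius a b c d z) := by
  obtain ⟨D, hD, h⟩ := exists_localDeriv_mobius hdet
  have hd := hasDerivAt_ratEval (P := conjNum φ a b c d) hz
  rw [h0, zero_div] at hd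
  have := h φ hφ _ z 0 (by
    filter_upwards [(conjDenom φ a b c d).continuous.continuousAt.eventually_ne hz] with w hw
    exact toMap_mobius hdet hw) hd
  rw [mul_zero] at this
  rw [IsCriticalPoint, toMap_mobius hdet hz]
  exact (mul_eq_zero.1 this).resolve_right (hD z)

theorem exists_mobius_pole_eq {K : Type*} [Field K] (x : OnePoint K) :
    ∃ a b c d : K, a * d - b * c ≠ 0 ∧ proj a c = x := by
  induction x with
  | infty => exact ⟨1, 0, 0, 1, by simp, proj_zero 1⟩
  | coe x => exact ⟨x, 1, 1, 0, by simp, proj_one x⟩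

/-- A map of degree at least two has a fixed point other than a given periodic point whose
multiplier is not `1`. -/
theorem exists_fixed_point_ne [IsAlgClosed K] (hφ : 2 ≤ degree φ) {n : ℕ} {γ : OnePoint K}
    (hmult : multiplier φ n γ ≠ 1) : ∃ x, toMap φ x = x ∧ x ≠ γ := by
  classical
  obtain ⟨x, hx⟩ := exists_ne γ
  obtain ⟨a, b, c, d, hdet, rfl⟩ := exists_mobius_pole_eq x
  obtain ⟨g, rfl⟩ := exists_mobius_eq hdet hx.symm
  by_cases hfix : toMap φ (proj a c) = proj a c
  · exact ⟨_, hfix, (mobius_ne hdet g).symm⟩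
  rw [toMap_proj_pole_iff hdet] at hfix
  obtain ⟨P, hP⟩ : ∃ P, P = conjNum φ a b c d := ⟨_, rfl⟩
  obtain ⟨Q, hQ⟩ : ∃ Q, Q = conjDenom φ a b c d := ⟨_, rfl⟩
  have hPd : P.natDegree ≤ degree φ := hP ▸ natDegree_conjNum_le φ
  rw [← hQ] at hfix
  -- The roots of `F` are the fixed points in this coordinate; as `∞` is not fixed, `F` has degree
  -- at least `degree φ + 1`.
  obtain ⟨F, hF⟩ : ∃ F, F = P - X * Q := ⟨_, rfl⟩
  have hFd : degree φ + 1 ≤ F.natDegree := by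
    refine le_natDegree_of_ne_zero ?_
    rw [hF, coeff_sub, coeff_X_mul, coeff_eq_zero_of_natDegree_lt (by omega), zero_sub]
    exact neg_ne_zero.2 hfix
  have hF0 : F ≠ 0 := by rintro h; rw [h, natDegree_zero] at hFd; omega
  have heval : ∀ z, F.eval z = P.eval z - z * Q.eval z := fun z => by simp [hF]
  have hroot : ∀ z, F.eval z = 0 → Q.eval z ≠ 0 ∧ ratEval P Q z = z := by
    intro z hz
    rw [heval] at hz
    have hQz : Q.eval z ≠ 0 := by
      intro h
      rw [h, mul_zero, sub_zero, hP] at hz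
      rw [hQ] at h
      exact conj_not_both_zero hdet z hz h
    exact ⟨hQz, by rw [ratEval, div_eq_iff hQz]; linear_combination hz⟩
  by_cases hz : ∃ z ∈ F.roots, z ≠ g
  · obtain ⟨z, hz, hzg⟩ := hz
    obtain ⟨h1, h2⟩ := hroot z (isRoot_of_mem_roots hz)
    refine ⟨mobius a b c d z, ?_, fun h => hzg (mobius_injective hdet h)⟩
    rw [hQ] at h1
    rw [toMap_mobius hdet h1, ← hP, ← hQ, h2]
  · push Not at hz
    exfalso
    apply hmult
    -- If `g` is the only root it is multiple, and `F(g) = F'(g) = 0` says that the derivative of `P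
    -- / Q` at `g` is `1`.
    have h2 : 1 < F.rootMultiplicity g := by
      rw [← count_roots, Multiset.eq_replicate_of_mem hz, Multiset.count_replicate_self,
        ← (IsAlgClosed.splits F).natDegree_eq_card_roots]
      omega
    obtain ⟨h3, h4⟩ := (one_lt_rootMultiplicity_iff_isRoot hF0).1 h2
    obtain ⟨hQg, hfg⟩ := hroot g h3
    have hder := hasDerivAt_ratEval (P := P) hQg
    have hone : (derivNum P Q).eval g / Q.eval g ^ 2 = 1 := by
      rw [div_eq_one_iff_eq (pow_ne_zero 2 hQg)]
      have h3' := heval g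
      rw [show F.eval g = 0 from h3] at h3'
      have h4' : (derivative P).eval g - Q.eval g - g * (derivative Q).eval g = 0 := by
        have : (derivative F).eval g = 0 := h4
        rw [hF] at this
        simp only [derivative_sub, derivative_mul, derivative_X, one_mul, eval_sub, eval_add,
          eval_mul, eval_X] at this
        linear_combination this
      rw [derivNum, eval_sub, eval_mul, eval_mul]
      linear_combination Q.eval g * h4' + (derivative Q).eval g * h3'
    rw [hone] at hder
    have hit := HasDerivAt.iterate _ hder hfg n
    rw [one_pow] at hit
    have hfgi : ∀ i, (ratEval P Q)^[i] g = g := Function.iterate_fixed hfg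
    rw [hP, hQ] at hit hfgi
    refine multiplier_eq (not_const_of_degree_pos (by omega)) hdet (fun i _ => ?_) (hfgi n) hit
    rw [hfgi, ← hQ]
    exact hQg

/-- Natural numbers prime to the residue characteristic have absolute value `1`. -/
theorem norm_natCast_eq_one {K : Type*} [NormedField K] [IsUltrametricDist K] (p : ℕ)
    [CharP (ResidueField K) p] {k : ℕ} (hk : ¬ p ∣ k) : ‖(k : K)‖ = 1 := by
  have h1 : ((k : ℕ) : ResidueField K) ≠ 0 := fun h => hk ((CharP.cast_eq_zero_iff _ p k).1 h)
  have h2 : IsUnit ((k : ℕ) : (NormedField.valuation (K := K)).valuationSubring) := by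
    by_contra h
    apply h1
    rw [← map_natCast (IsLocalRing.residue _)]
    exact (IsLocalRing.residue_eq_zero_iff _).2 ((IsLocalRing.mem_maximalIdeal _).2 h)
  obtain ⟨u, hu⟩ := h2
  have hle : ∀ x : (NormedField.valuation (K := K)).valuationSubring, ‖(x : K)‖ ≤ 1 := fun x => by
    have := x.2
    rw [Valuation.mem_valuationSubring_iff] at this
    exact_mod_cast this
  have hmul : ((u : (NormedField.valuation (K := K)).valuationSubring) : K)
      * ((u⁻¹ : (NormedField.valuation (K := K)).valuationSubringˣ) :
        (NormedField.valuation (K := K)).valuationSubring) = 1 := by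
    rw [← MulMemClass.coe_mul, Units.mul_inv]; rfl
  rw [hu] at hmul
  have hn := congrArg norm hmul
  rw [norm_mul, norm_one] at hn
  have h3 := hle (k : (NormedField.valuation (K := K)).valuationSubring)
  have h4 := hle (u⁻¹ : (NormedField.valuation (K := K)).valuationSubringˣ)
  have h5 : (((k : ℕ) : (NormedField.valuation (K := K)).valuationSubring) : K) = k := by simp
  rw [h5] at hn h3
  have := norm_nonneg (k : K)
  nlinarith

end Multiplier

end RationalDynamics

/-! ### Transfer of the affine result to `P¹(K)`. -/

theorem theorem1p4 {K : Type*} [NontriviallyNormedField K] [IsUltrametricDist K]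
    [CompleteSpace K] [IsAlgClosed K]
    (p : ℕ) [CharP (RationalDynamics.ResidueField K) p]
    (φ : RatFunc K) (hd : 2 ≤ RationalDynamics.degree φ)
    (hp : p = 0 ∨ RationalDynamics.degree φ < p)
    (n : ℕ) (hn : 1 ≤ n) (γ : OnePoint K)
    (hγ : (RationalDynamics.toMap φ)^[n] γ = γ)
    (h_pos : 0 < ‖RationalDynamics.multiplier φ n γ‖)
    (h_lt : ‖RationalDynamics.multiplier φ n γ‖ < 1) :
    ∃ c : OnePoint K, RationalDynamics.IsCriticalPoint φ c ∧
      RationalDynamics.StrictlyAttracts φ n γ c := by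
  open RationalDynamics in
  have hφ : ¬ ∃ c, φ = RatFunc.C c := not_const_of_degree_pos (by omega)
  obtain ⟨x, hx, hxγ⟩ := exists_fixed_point_ne hd (n := n) (γ := γ)
    (by intro h; rw [h, norm_one] at h_lt; exact lt_irrefl _ h_lt)
  obtain ⟨a, b, c, d, hdet, rfl⟩ := exists_mobius_pole_eq x
  obtain ⟨g, rfl⟩ := exists_mobius_eq hdet hxγ.symm
  obtain ⟨hP, hQ⟩ := natDegree_conj_of_fixed hdet hx (by omega)
  have hpole := conjDenom_eval_iterate_ne_zero hdet hx hn hγ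
  have hper := mobius_injective hdet
    ((iterate_toMap_mobius hdet n fun i _ => hpole i).symm.trans hγ)
  have hμ := (differentiableAt_iterate_ratEval n fun i _ => hpole i).hasDerivAt
  rw [multiplier_eq hφ hdet (fun i _ => hpole i) hper hμ] at h_pos h_lt
  -- A positive `k ≤ degree φ` is not divisible by `p`, both for `p = 0` and for `degree φ < p`.
  have htame : ∀ k : ℕ, 1 ≤ k → k ≤ (conjNum φ a b c d).natDegree → ‖(k : K)‖ = 1 := by
    intro k hk hk'
    refine norm_natCast_eq_one p fun hpk => ?_
    rcases hp with rfl | hp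
    · rw [zero_dvd_iff] at hpk; omega
    · have := Nat.le_of_dvd hk hpk; omega
  obtain ⟨z, hz, hzpole, hzg, k, hk, hlim⟩ := exists_critical_point_strictly_attracted
    (by omega) (by omega) htame (conj_not_both_zero hdet) hn hper hpole hμ h_pos h_lt
  have horb : ∀ m, (toMap φ)^[m] (mobius a b c d z) = mobius a b c d _ := fun m =>
    iterate_toMap_mobius hdet m fun i _ => hzpole i
  refine ⟨mobius a b c d z, isCriticalPoint_mobius hφ hdet (hzpole 0) hz, ⟨k, hk, ?_⟩,
    fun l _ h => ?_⟩
  · simp only [horb, iterate_toMap_mobius hdet k fun i _ => hpole i]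
    exact tendsto_chordalDist_mobius hdet hlim
  · rw [horb] at h
    exact hzg l (mobius_injective hdet h)
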